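/- Let $\mathbb{B}^{11}$ be the open unit ball of $\mathbb{R}^{11}$. For an integer $m\ge 0$ let $H^m_{\mathrm{rad}}(\mathbb{B}^{11})$ be the space of all (profiles of) radial functions $\hat u(\xi)=u(|\xi|)$, $u:[0,1)\to\mathbb{C}$, with $\hat u\in H^m(\mathbb{B}^{11})=W^{m,2}(\mathbb{B}^{11})$, normed by $$\|u\|_{H^m_{\mathrm{rad}}(\mathbb{B}^{11})}:=\|\hat u\|_{H^m(\mathbb{B}^{11})}=\Big(\sum_{|\alpha|\le m}\|\partial^\alpha \hat u\|_{L^2(\mathbb{B}^{11})}^2\Big)^{1/2}.$$ Let $\mathcal{H}:=H^6_{\mathrm{rad}}(\mathbb{B}^{11})\times H^5_{\mathrm{rad}}(\mathbb{B}^{11})$ with the norm $$\|\mathbf{u}\|^2=\|(u_1,u_2)\|^2:=\|u_1\|_{H^6_{\mathrm{rad}}(\mathbb{B}^{11})}^2+\|u_2\|_{H^5_{\mathrm{rad}}(\mathbb{B}^{11})}^2,$$ and let $\mathcal{B}_\delta:=\{\mathbf{u}\in\mathcal{H}:\|\mathbf{u}\|\le\delta\}$. Put $$\phi_0(\rho)=\frac{3\rho}{\sqrt{2(155-74\rho^2)}},\qquad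 n(x)=14x^3-111x^5,$$ $$N(\rho,z)=-\frac{8}{\rho^3}\big[n(\phi_0(\rho)+\rho z)-n(\phi_0(\rho))-n'(\phi_0(\rho))\,\rho z\big],$$ and, for $\mathbf{u}=(u_1,u_2)$, let $\mathbf{N}(\mathbf{u})(\rho):=\big(0,\,N(\rho,u_1(\rho))\big)$. Let $\delta>0$. Then $\mathbf{N}(\mathbf{u})\in\mathcal{H}$ for every $\mathbf{u}\in\mathcal{B}_\delta$, and there is a constant $c>0$, depending only on $\delta$, such that for all $\mathbf{u},\mathbf{v}\in\mathcal{B}_\delta$ $$\|\mathbf{N}(\mathbf{u})-\mathbf{N}(\mathbf{v})\|\le c\,\big(\|\mathbf{u}\|+\|\mathbf{v}\|\big)\,\|\mathbf{u}-\mathbf{v}\|.$$ -/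

import Mathlib

open MeasureTheory
open scoped ContDiff

noncomputable section

namespace RadialWave

/-! ### Sobolev spaces `H^m(Ω) = W^{m,2}(Ω)` of complex-valued functions -/

/-- The first-order partial derivative `∂_i φ`. -/
def partialDeriv {d : ℕ} (i : Fin d) (φ : EuclideanSpace ℝ (Fin d) → ℝ) :
    EuclideanSpace ℝ (Fin d) → ℝ :=
  fun x => lineDeriv ℝ φ x (EuclideanSpace.single i 1)

/-- The partial derivative `∂^α φ = ∂_0^{α 0} ∂_1^{α 1} ⋯ φ` for a multi-index `α`. -/
def multiDeriv {d : ℕ} (α : Fin d → ℕ) (φ : EuclideanSpace ℝ (Fin d) → ℝ) :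
    EuclideanSpace ℝ (Fin d) → ℝ :=
  (List.finRange d).foldr (fun i ψ => (partialDeriv i)^[α i] ψ) φ

/-- `g` is a weak derivative `∂^α f` on the open set `Ω`: both are locally integrable on `Ω`, and
`∫_Ω f ∂^α φ = (-1)^{|α|} ∫_Ω g φ` for every test function `φ ∈ C_c^∞(Ω)`. -/
def IsWeakDeriv {d : ℕ} (Ω : Set (EuclideanSpace ℝ (Fin d))) (α : Fin d → ℕ)
    (f g : EuclideanSpace ℝ (Fin d) → ℂ) : Prop :=
  LocallyIntegrableOn f Ω ∧ LocallyIntegrableOn g Ω ∧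
    ∀ φ : EuclideanSpace ℝ (Fin d) → ℝ, ContDiff ℝ ∞ φ → HasCompactSupport φ → tsupport φ ⊆ Ω →
      ∫ x in Ω, multiDeriv α φ x • f x = (-1) ^ (∑ i, α i) * ∫ x in Ω, φ x • g x

/-- The finite set of all multi-indices `α` with `|α| ≤ m`. -/
def multiIndices (d m : ℕ) : Finset (Fin d → ℕ) :=
  (Finset.range (m + 1)).biUnion fun k => Finset.piAntidiag Finset.univ k

/-- `f ∈ H^m(Ω)`: for every `|α| ≤ m` the weak derivative `∂^α f` exists and lies in `L²(Ω)`. -/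
def MemSobolev {d : ℕ} (Ω : Set (EuclideanSpace ℝ (Fin d))) (m : ℕ)
    (f : EuclideanSpace ℝ (Fin d) → ℂ) : Prop :=
  ∀ α ∈ multiIndices d m, ∃ g, IsWeakDeriv Ω α f g ∧ MemLp g 2 (volume.restrict Ω)

open Classical in
/-- A representative of the weak derivative `∂^α f` on `Ω` (which is unique up to null sets);
it is `0` if there is no weak derivative. -/
def weakDeriv {d : ℕ} (Ω : Set (EuclideanSpace ℝ (Fin d))) (α : Fin d → ℕ)
    (f : EuclideanSpace ℝ (Fin d) → ℂ) : EuclideanSpace ℝ (Fin d) → ℂ :=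
  if h : ∃ g, IsWeakDeriv Ω α f g then h.choose else 0

/-- The norm `‖f‖_{H^m(Ω)} = (∑_{|α| ≤ m} ‖∂^α f‖²_{L²(Ω)})^{1/2}` of `f ∈ H^m(Ω)`. -/
def sobolevNorm {d : ℕ} (Ω : Set (EuclideanSpace ℝ (Fin d))) (m : ℕ)
    (f : EuclideanSpace ℝ (Fin d) → ℂ) : ℝ :=
  √(∑ α ∈ multiIndices d m, ∫ x in Ω, ‖weakDeriv Ω α f x‖ ^ 2)

/-! ### Radial Sobolev spaces on the unit ball of `ℝ^11` and the space `𝓗`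

A radial function is given by its profile `u`. Profiles are total functions on `ℝ`, but only their
values on `[0, 1)` enter. -/

/-- The open unit ball `𝔹^11`. -/
def unitBall : Set (EuclideanSpace ℝ (Fin 11)) := Metric.ball 0 1

/-- The radial function `û(ξ) = u(|ξ|)` with profile `u`. -/
def radialExt (u : ℝ → ℂ) : EuclideanSpace ℝ (Fin 11) → ℂ := fun ξ => u ‖ξ‖

/-- `u ∈ H^m_rad(𝔹^11)`. -/
def MemHRad (m : ℕ) (u : ℝ → ℂ) : Prop := MemSobolev unitBall m (radialExt u)

/-- The norm of `H^m_rad(𝔹^11)`. -/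
def normHRad (m : ℕ) (u : ℝ → ℂ) : ℝ := sobolevNorm unitBall m (radialExt u)

/-- The space `𝓗 = H^6_rad(𝔹^11) × H^5_rad(𝔹^11)`. -/
def spaceH : Set ((ℝ → ℂ) × (ℝ → ℂ)) := {u | MemHRad 6 u.1 ∧ MemHRad 5 u.2}

/-- The norm `‖u‖ = (‖u₁‖²_{H^6} + ‖u₂‖²_{H^5})^{1/2}` of `𝓗`. -/
def normH (u : (ℝ → ℂ) × (ℝ → ℂ)) : ℝ := √(normHRad 6 u.1 ^ 2 + normHRad 5 u.2 ^ 2)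

/-- The closed ball `𝓑_δ` of `𝓗`. -/
def ballH (δ : ℝ) : Set ((ℝ → ℂ) × (ℝ → ℂ)) := {u | u ∈ spaceH ∧ normH u ≤ δ}

/-! ### The nonlinearity -/

/-- The profile `φ₀(ρ) = 3ρ / √(2(155 - 74ρ²))` of the self-similar blowup solution. -/
def phi0 (ρ : ℝ) : ℝ := 3 * ρ / √(2 * (155 - 74 * ρ ^ 2))

/-- `n(x) = 14x³ - 111x⁵`. -/
def nPoly (x : ℂ) : ℂ := 14 * x ^ 3 - 111 * x ^ 5

/-- `N(ρ, z) = -(8/ρ³) [n(φ₀(ρ) + ρz) - n(φ₀(ρ)) - n'(φ₀(ρ)) ρz]`. -/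
def scalarN (ρ : ℝ) (z : ℂ) : ℂ :=
  -(8 / (ρ : ℂ) ^ 3) *
    (nPoly (phi0 ρ + ρ * z) - nPoly (phi0 ρ) - deriv nPoly (phi0 ρ) * (ρ * z))

/-- The nonlinear operator `𝐍(u)(ρ) = (0, N(ρ, u₁(ρ)))`. -/
def opN (u : (ℝ → ℂ) × (ℝ → ℂ)) : (ℝ → ℂ) × (ℝ → ℂ) := (0, fun ρ => scalarN ρ (u.1 ρ))

end RadialWave

end

/-! Taylor expansion of the quintic `nPoly` at `phi0 ρ` removes the terms of order 0 and 1 in `z`,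
and since `phi0 ρ` is `ρ` times a smooth function of `ρ²`, the factor `1/ρ³` cancels. Off the
origin, `N(|ξ|, z)` is thus `∑ A_k(ξ) z^(k+2)`, `k = 0, …, 3`, with coefficients `A_k` that extend
smoothly to all of `ℝ^11`. What remains is that `f ↦ ∑ A_k f^(k+2)` is locally Lipschitz from `H^6`
to `H^5`, with a Lipschitz factor vanishing linearly at the origin.

This rests on `6 > 11/2`, used through the scale of exponents `12/k`. One derivative buys a gain of
`1/12` in reciprocal exponent, because `1/12 < 1/11`; so an `H^6` function has its `k`-th derivative
in `L^(12/k)` for `k ≤ 6` (`jetNorm_le_derivNorm`), where `k = 0` means `L^∞`. As `i/12 + (k-i)/12 =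
k/12`, Leibniz and Hölder make the sum of these norms submultiplicative (`jetNorm_mul_le`). Since
`12/k ≥ 2` and the ball has finite measure, it controls the `L²` norms again. The Sobolev step
`eLpNorm_le_eLpNorm_fderiv` comes from averaging the fundamental theorem of calculus over segments
in the ball.

These estimates are made for smooth functions. Dilating and then mollifying approximates an `H^m`
function on the ball by functions smooth on the whole space (`MemSobolev.exists_sobolevApprox`). The
increment estimate makes the images of such a sequence Cauchy; completeness of `L²` and closedness
of weak derivatives then carry both membership and the inequality to the limit
(`weakNorm_polyMap_sub_le`). -/

noncomputable section

namespace RadialWave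

/-! ### Iterated partial derivatives of smooth functions -/

section Derivatives

variable {d : ℕ} {V : Type*} [NormedAddCommGroup V] [NormedSpace ℝ V]

/-- The iterated partial derivative of `F` along the coordinate directions listed in `l`. -/
def listDeriv (l : List (Fin d)) (F : EuclideanSpace ℝ (Fin d) → V) :
    EuclideanSpace ℝ (Fin d) → V :=
  l.foldr (fun i ψ x => lineDeriv ℝ ψ x (EuclideanSpace.single i 1)) F

/-- The list of coordinate directions, in increasing order, in which `∂^α` differentiates. -/
def indexList (α : Fin d → ℕ) : List (Fin d) :=
  (List.finRange d).flatMap fun i => List.replicate (α i) i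

theorem length_indexList (α : Fin d → ℕ) : (indexList α).length = ∑ i, α i := by
  simp [indexList, List.length_flatMap, ← List.ofFn_eq_map, List.sum_ofFn]

theorem multiDeriv_eq_listDeriv (α : Fin d → ℕ) (φ : EuclideanSpace ℝ (Fin d) → ℝ) :
    multiDeriv α φ = listDeriv (indexList α) φ := by
  unfold multiDeriv listDeriv indexList
  induction List.finRange d with
  | nil => rfl
  | cons i L ih =>
    rw [List.foldr_cons, ih, List.flatMap_cons, List.foldr_append]
    generalize List.foldr _ φ (List.flatMap _ L) = ψ
    induction α i with
    | zero => rfl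
    | succ n ihn => rw [Function.iterate_succ_apply', ihn, List.replicate_succ, List.foldr_cons]; rfl

theorem listDeriv_apply {F : EuclideanSpace ℝ (Fin d) → V} (hF : ContDiff ℝ ∞ F)
    (l : List (Fin d)) (x : EuclideanSpace ℝ (Fin d)) :
    listDeriv l F x =
      iteratedFDeriv ℝ l.length F x fun k => EuclideanSpace.single (l.get k) 1 := by
  induction l generalizing x with
  | nil => simp [listDeriv]
  | cons i l ih =>
    have h : listDeriv (i :: l) F x =
        lineDeriv ℝ (listDeriv l F) x (EuclideanSpace.single i 1) := rfl
    have hd : DifferentiableAt ℝ (iteratedFDeriv ℝ l.length F) x :=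
      (hF.differentiable_iteratedFDeriv (by exact_mod_cast ENat.natCast_lt_top _)) x
    rw [h, funext ih, DifferentiableAt.lineDeriv_eq_fderiv (hd.continuousMultilinear_apply_const _)]
    rw [fderiv_continuousMultilinear_apply_const hd]
    exact (iteratedFDeriv_succ_apply_left (n := l.length)
      fun k => EuclideanSpace.single ((i :: l).get k) (1 : ℝ)).symm

theorem contDiff_listDeriv {F : EuclideanSpace ℝ (Fin d) → V} (hF : ContDiff ℝ ∞ F)
    (l : List (Fin d)) : ContDiff ℝ ∞ (listDeriv l F) := by
  rw [funext (listDeriv_apply hF l)]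
  have : ContDiff ℝ ∞ (iteratedFDeriv ℝ l.length F) := hF.iteratedFDeriv_right (by norm_cast)
  exact (ContinuousMultilinearMap.apply ℝ (fun _ => EuclideanSpace ℝ (Fin d)) V
    fun k : Fin l.length => EuclideanSpace.single (l.get k) (1 : ℝ)).contDiff.comp this

theorem listDeriv_append (l l' : List (Fin d)) (F : EuclideanSpace ℝ (Fin d) → V) :
    listDeriv (l ++ l') F = listDeriv l (listDeriv l' F) := List.foldr_append

theorem norm_listDeriv_le {F : EuclideanSpace ℝ (Fin d) → V} (hF : ContDiff ℝ ∞ F)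
    (l : List (Fin d)) (x : EuclideanSpace ℝ (Fin d)) :
    ‖listDeriv l F x‖ ≤ ‖iteratedFDeriv ℝ l.length F x‖ := by
  rw [listDeriv_apply hF]
  refine (ContinuousMultilinearMap.le_opNorm _ _).trans ?_
  simp

/-- Permutations are generated by adjacent swaps, and a swap is the symmetry of the second
derivative. Hence any list of directions can be sorted into the `indexList` of a multi-index. -/
theorem listDeriv_perm {F : EuclideanSpace ℝ (Fin d) → V} (hF : ContDiff ℝ ∞ F)
    {l l' : List (Fin d)} (h : l.Perm l') : listDeriv l F = listDeriv l' F := by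
  induction h with
  | nil => rfl
  | cons i _ ih =>
    change listDeriv [i] (listDeriv _ F) = listDeriv [i] (listDeriv _ F)
    rw [ih]
  | swap i j l =>
    change listDeriv [j, i] (listDeriv l F) = listDeriv [i, j] (listDeriv l F)
    have hG := contDiff_listDeriv hF l
    funext x
    rw [listDeriv_apply hG, listDeriv_apply hG]
    have h := (hG.contDiffAt (x := x)).isSymmSndFDerivAt (by
      simp only [minSmoothness_of_isRCLikeNormedField]; norm_cast)
    simp only [List.length_cons, List.length_nil, Nat.reduceAdd]
    rw [iteratedFDeriv_two_apply, iteratedFDeriv_two_apply]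
    exact h _ _
  | trans _ _ ih₁ ih₂ => exact ih₁.trans ih₂

theorem indexList_count_perm (l : List (Fin d)) : (indexList fun i => l.count i).Perm l := by
  rw [List.perm_iff_count]
  intro j
  simp only [indexList, List.count_flatMap, Function.comp_def, List.count_replicate]
  rw [← List.ofFn_eq_map, List.sum_ofFn]
  simp

theorem sum_count (l : List (Fin d)) : ∑ i, l.count i = l.length := by
  rw [← length_indexList, (indexList_count_perm l).length_eq]

theorem norm_iteratedFDeriv_le_sum {F : EuclideanSpace ℝ (Fin d) → V} (hF : ContDiff ℝ ∞ F)
    (k : ℕ) (x : EuclideanSpace ℝ (Fin d)) :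
    ‖iteratedFDeriv ℝ k F x‖ ≤ ∑ s : Fin k → Fin d, ‖listDeriv (List.ofFn s) F x‖ := by
  refine ContinuousMultilinearMap.opNorm_le_bound (by positivity) fun v => ?_
  -- Expanding every argument in the standard basis turns multilinearity into a sum over all words
  -- of length `k` in the coordinate directions.
  have hv : v = fun k => ∑ i, (v k i) • (EuclideanSpace.single i 1 : EuclideanSpace ℝ (Fin d)) := by
    funext k
    ext j
    simp [Finset.sum_apply, Pi.single_apply]
  conv_lhs => rw [hv]
  rw [ContinuousMultilinearMap.map_sum, Finset.sum_mul]
  refine (norm_sum_le _ _).trans (Finset.sum_le_sum fun s _ => ?_)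
  rw [ContinuousMultilinearMap.map_smul_univ, norm_smul, mul_comm]
  have h1 : listDeriv (List.ofFn s) F x =
      iteratedFDeriv ℝ k F x fun k => EuclideanSpace.single (s k) 1 := by
    rw [listDeriv_apply hF]
    have : ∀ (n : ℕ) (hn : n = k), (iteratedFDeriv ℝ n F x fun j =>
        EuclideanSpace.single (s (Fin.cast hn j)) (1 : ℝ)) =
        iteratedFDeriv ℝ k F x fun k => EuclideanSpace.single (s k) 1 := by
      rintro n rfl
      rfl
    rw [← this _ (List.length_ofFn (f := s))]
    simp [Fin.cast]
  rw [h1, norm_prod]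
  gcongr with i
  exact PiLp.norm_apply_le (v i) (s i)

theorem lineDeriv_comp_affine {G : EuclideanSpace ℝ (Fin d) → V} (hG : Differentiable ℝ G)
    (a x v : EuclideanSpace ℝ (Fin d)) (c : ℝ) :
    lineDeriv ℝ (fun y => G (a + c • y)) x v = c • lineDeriv ℝ G (a + c • x) v := by
  have h : HasFDerivAt (fun y : EuclideanSpace ℝ (Fin d) => a + c • y)
      (c • ContinuousLinearMap.id ℝ (EuclideanSpace ℝ (Fin d))) x :=
    ((hasFDerivAt_id x).const_smul c).const_add a
  have h2 := ((hG (a + c • x)).hasFDerivAt.comp x h)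
  rw [(hG _).lineDeriv_eq_fderiv]
  refine (h2.hasLineDerivAt v).lineDeriv.trans ?_
  simp

theorem listDeriv_comp_affine {G : EuclideanSpace ℝ (Fin d) → V} (hG : ContDiff ℝ ∞ G)
    (a : EuclideanSpace ℝ (Fin d)) (c : ℝ) (l : List (Fin d)) (x : EuclideanSpace ℝ (Fin d)) :
    listDeriv l (fun y => G (a + c • y)) x = c ^ l.length • listDeriv l G (a + c • x) := by
  induction l generalizing x with
  | nil => simp [listDeriv]
  | cons i l ih =>
    have hd := (contDiff_listDeriv hG l).differentiable (by simp)
    change lineDeriv ℝ (listDeriv l _) x _ = c ^ (l.length + 1) • lineDeriv ℝ (listDeriv l G) _ _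
    rw [funext ih]
    have h : LineDifferentiableAt ℝ (fun y => listDeriv l G (a + c • y)) x
        (EuclideanSpace.single i 1) :=
      (hd.comp (by fun_prop : Differentiable ℝ fun y : EuclideanSpace ℝ (Fin d) =>
        a + c • y)).differentiableAt.lineDifferentiableAt
    have h' : HasLineDerivAt ℝ (fun y => c ^ l.length • listDeriv l G (a + c • y))
        (c ^ l.length • lineDeriv ℝ (fun y => listDeriv l G (a + c • y)) x
          (EuclideanSpace.single i 1)) x (EuclideanSpace.single i 1) :=
      HasDerivAt.const_smul (c ^ l.length) h.hasLineDerivAt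
    rw [h'.lineDeriv, lineDeriv_comp_affine hd, smul_smul, pow_succ]

end Derivatives

/-! ### A Sobolev inequality on the unit ball -/

section Sobolev

open Set
open scoped ENNReal NNReal

theorem rpow_lintegral_le {X : Type*} [MeasurableSpace X] (ν : Measure X) {p : ℝ} (hp : 1 < p)
    {g : X → ℝ≥0∞} (hg : AEMeasurable g ν) :
    (∫⁻ x, g x ∂ν) ^ p ≤ ν univ ^ (p - 1) * ∫⁻ x, g x ^ p ∂ν := by
  have hpq := Real.HolderConjugate.conjExponent hp
  have h := ENNReal.lintegral_mul_le_Lp_mul_Lq ν hpq hg (aemeasurable_const (b := (1 : ℝ≥0∞)))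
  simp only [Pi.mul_apply, mul_one, ENNReal.one_rpow, lintegral_const, one_mul] at h
  refine (ENNReal.rpow_le_rpow h (by linarith)).trans_eq ?_
  rw [ENNReal.mul_rpow_of_nonneg _ _ (by linarith), ← ENNReal.rpow_mul, ← ENNReal.rpow_mul,
    one_div_mul_cancel (by linarith), ENNReal.rpow_one, mul_comm]
  congr 2
  rw [Real.conjExponent]
  field_simp

variable {d : ℕ}

local notation "𝔼" => EuclideanSpace ℝ (Fin d)
local notation "𝔹" => Metric.ball (0 : EuclideanSpace ℝ (Fin d)) 1

theorem lintegral_comp_affine {h : 𝔼 → ℝ≥0∞} (hh : Measurable h) (b : 𝔼) {t : ℝ} (ht : 0 < t) :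
    ∫⁻ y, h (b + t • y) = ENNReal.ofReal (t⁻¹ ^ d) * ∫⁻ y, h y := by
  have h1 : ∫⁻ y, h (b + t • y) = ∫⁻ y, h (b + y) ∂(Measure.map (t • ·) volume) := by
    rw [lintegral_map (by fun_prop) (by fun_prop)]
  rw [h1, Measure.map_addHaar_smul _ ht.ne', lintegral_smul_measure,
    lintegral_add_left_eq_self (fun y => h y) b]
  simp [abs_of_pos ht]

theorem segment_mem_ball {x y : 𝔼} (hx : x ∈ 𝔹) (hy : y ∈ 𝔹) {t : ℝ} (h0 : 0 ≤ t) (h1 : t ≤ 1) :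
    (1 - t) • x + t • y ∈ 𝔹 :=
  (convex_ball _ _) hx hy (by linarith) h0 (by ring)

/-- By convexity `y ↦ (1 - t) x + t y` maps the ball into itself, and its Jacobian is `t^d`. -/
theorem lintegral_ball_segment_le {h : 𝔼 → ℝ≥0∞} (hh : Measurable h) {x : 𝔼} (hx : x ∈ 𝔹)
    {t : ℝ} (h0 : 0 < t) (h1 : t ≤ 1) :
    ∫⁻ y in 𝔹, h ((1 - t) • x + t • y) ≤ ENNReal.ofReal (t⁻¹ ^ d) * ∫⁻ y in 𝔹, h y := by
  rw [← lintegral_indicator Metric.isOpen_ball.measurableSet (f := h),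
    ← lintegral_comp_affine (hh.indicator Metric.isOpen_ball.measurableSet) ((1 - t) • x) h0,
    ← lintegral_indicator Metric.isOpen_ball.measurableSet]
  refine lintegral_mono fun y => ?_
  by_cases hy : y ∈ 𝔹
  · rw [indicator_of_mem hy, indicator_of_mem (segment_mem_ball hx hy h0.le h1)]
  · rw [indicator_of_notMem hy]
    exact zero_le

/-- Integrating in `x` as well removes the singularity at `t = 0`: the expression is symmetric under
swapping `x, y` and `t, 1 - t`, so the change of variables can be made in whichever variable has
weight at least `1/2`. -/
theorem lintegral_lintegral_ball_segment_le {h : 𝔼 → ℝ≥0∞} (hh : Measurable h)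
    {t : ℝ} (h0 : 0 < t) (h1 : t < 1) :
    ∫⁻ x in 𝔹, ∫⁻ y in 𝔹, h ((1 - t) • x + t • y) ≤
      ENNReal.ofReal (2 ^ d) * (∫⁻ y in 𝔹, h y) * volume 𝔹 := by
  have key : ∀ s : ℝ, 1 / 2 ≤ s → s < 1 → ∫⁻ x in 𝔹, ∫⁻ y in 𝔹, h ((1 - s) • x + s • y) ≤
      ENNReal.ofReal (2 ^ d) * (∫⁻ y in 𝔹, h y) * volume 𝔹 := by
    intro s hs hs1
    rw [← setLIntegral_const]
    refine setLIntegral_mono' Metric.isOpen_ball.measurableSet fun x hx => ?_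
    refine (lintegral_ball_segment_le hh hx (by linarith) hs1.le).trans ?_
    gcongr
    rw [inv_le_comm₀ (by linarith) (by norm_num)]
    linarith
  rcases le_total (1 / 2) t with ht | ht
  · exact key t ht h1
  · rw [lintegral_lintegral_swap (by fun_prop)]
    refine le_trans (le_of_eq ?_) (key (1 - t) (by linarith) (by linarith))
    simp only [sub_sub_cancel, add_comm]

/-- The average over `y` in the unit ball of the line integral of `g` over the segment `[x, y]`,
up to normalization. -/
def segmentPotential (g : 𝔼 → ℝ≥0∞) (x : 𝔼) : ℝ≥0∞ :=
  ∫⁻ t in Ioo (0 : ℝ) 1, ∫⁻ y in 𝔹, g ((1 - t) • x + t • y)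

theorem lintegral_ball_segment_le_rpow {g : 𝔼 → ℝ≥0∞} (hg : Measurable g) {p : ℝ} (hp : 1 < p)
    (x : 𝔼) (t : ℝ) :
    ∫⁻ y in 𝔹, g ((1 - t) • x + t • y) ≤
      volume 𝔹 ^ (1 - p⁻¹) * (∫⁻ y in 𝔹, g ((1 - t) • x + t • y) ^ p) ^ p⁻¹ := by
  have h := rpow_lintegral_le (volume.restrict 𝔹) hp
    (g := fun y => g ((1 - t) • x + t • y)) (by fun_prop)
  have h2 := ENNReal.rpow_le_rpow h (z := p⁻¹) (by positivity)
  rw [← ENNReal.rpow_mul, mul_inv_cancel₀ (by linarith), ENNReal.rpow_one,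
    ENNReal.mul_rpow_of_nonneg _ _ (by positivity), ← ENNReal.rpow_mul,
    Measure.restrict_apply_univ] at h2
  convert h2 using 3
  field_simp

theorem lintegral_Ioo_rpow_lt_top {θ : ℝ} (hθ : θ < 1) :
    ∫⁻ t in Ioo (0 : ℝ) 1, ENNReal.ofReal (t ^ (-θ)) < ⊤ := by
  have h : IntegrableOn (fun t : ℝ => t ^ (-θ)) (Ioo 0 1) :=
    (intervalIntegral.integrableOn_Ioo_rpow_iff one_pos).2 (by linarith)
  exact h.lintegral_lt_top

theorem ofReal_inv_pow_rpow {t : ℝ} (ht : 0 < t) (s : ℝ) :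
    ENNReal.ofReal (t⁻¹ ^ d) ^ s = ENNReal.ofReal (t ^ (-(d * s))) := by
  rw [ENNReal.ofReal_rpow_of_pos (by positivity), ← Real.rpow_natCast, ← Real.rpow_mul
    (by positivity), Real.inv_rpow ht.le, Real.rpow_neg ht.le]

/-- The endpoint `r = ∞`: Hölder in `y` and the change of variables leave `t^(-d/p)`, which is
integrable on `(0, 1)` as `d/p < 1`. -/
theorem segmentPotential_le_of_lt {p : ℝ} (hp : 1 < p) (hd : d * p⁻¹ < 1) :
    ∃ C : ℝ≥0, ∀ g : 𝔼 → ℝ≥0∞, Measurable g → ∀ x ∈ 𝔹,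
      segmentPotential g x ≤ C * (∫⁻ y in 𝔹, g y ^ p) ^ p⁻¹ := by
  have hC : volume 𝔹 ^ (1 - p⁻¹) * ∫⁻ t in Ioo (0 : ℝ) 1, ENNReal.ofReal (t ^ (-(d * p⁻¹))) ≠ ⊤ :=
    ENNReal.mul_ne_top (ENNReal.rpow_ne_top_of_nonneg
      (by linarith [inv_lt_one_of_one_lt₀ hp]) measure_ball_lt_top.ne)
      (lintegral_Ioo_rpow_lt_top hd).ne
  refine ⟨(volume 𝔹 ^ (1 - p⁻¹) *
    ∫⁻ t in Ioo (0 : ℝ) 1, ENNReal.ofReal (t ^ (-(d * p⁻¹)))).toNNReal, fun g hg x hx => ?_⟩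
  rw [ENNReal.coe_toNNReal hC, mul_assoc, ← lintegral_mul_const _ (by fun_prop),
    ← lintegral_const_mul _ (by fun_prop)]
  refine setLIntegral_mono' measurableSet_Ioo fun t ht => ?_
  refine (lintegral_ball_segment_le_rpow hg hp x t).trans ?_
  gcongr
  refine (ENNReal.rpow_le_rpow (lintegral_ball_segment_le (h := fun y => g y ^ p) (by fun_prop)
    hx ht.1 ht.2.le) (by positivity)).trans_eq ?_
  rw [ENNReal.mul_rpow_of_nonneg _ _ (by positivity), ofReal_inv_pow_rpow ht.1]

/-- With `M` the integral of `g^p` along the contraction, write `M^(1/p) = M^(1/p - 1/r) M^(1/r)`.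
The first factor is bounded pointwise by a multiple of `t^(-θ)`, with `θ < 1`; the second is handled
by Jensen for the finite measure `t^(-θ) dt` and by the nonsingular double integral. -/
theorem lintegral_segmentPotential_rpow_le {p r : ℝ} (hp : 1 < p) (hpr : p < r)
    (hd : d * (p⁻¹ - r⁻¹) < 1) :
    ∃ C : ℝ≥0, ∀ g : 𝔼 → ℝ≥0∞, Measurable g →
      ∫⁻ x in 𝔹, segmentPotential g x ^ r ≤ C * (∫⁻ y in 𝔹, g y ^ p) ^ (r / p) := by
  set θ := d * (p⁻¹ - r⁻¹) with hθ
  have hr : 1 < r := hp.trans hpr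
  have hpr' : 0 ≤ p⁻¹ - r⁻¹ := by
    rw [sub_nonneg]
    exact inv_anti₀ (by linarith) hpr.le
  set ν := (volume.restrict (Ioo (0 : ℝ) 1)).withDensity fun t => ENNReal.ofReal (t ^ (-θ)) with hν
  have hνu : ν univ ≠ ⊤ := by
    rw [hν, withDensity_apply _ MeasurableSet.univ, Measure.restrict_univ]
    exact (lintegral_Ioo_rpow_lt_top hd).ne
  have hνac : ∀ᵐ t ∂ν, t ∈ Ioo (0 : ℝ) 1 :=
    (withDensity_absolutelyContinuous _ _).ae_le (ae_restrict_mem measurableSet_Ioo)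
  have : IsFiniteMeasure ν := ⟨hνu.lt_top⟩
  set K : ℝ≥0∞ := volume 𝔹 ^ (r * (1 - p⁻¹)) * ν univ ^ (r - 1) *
    (ENNReal.ofReal (2 ^ d) * volume 𝔹 * ν univ) with hK
  have hKtop : K ≠ ⊤ := by
    have : 0 ≤ r * (1 - p⁻¹) := mul_nonneg (by linarith) (by linarith [inv_lt_one_of_one_lt₀ hp])
    exact ENNReal.mul_ne_top (ENNReal.mul_ne_top
      (ENNReal.rpow_ne_top_of_nonneg this measure_ball_lt_top.ne)
      (ENNReal.rpow_ne_top_of_nonneg (by linarith) hνu))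
      (ENNReal.mul_ne_top (ENNReal.mul_ne_top ENNReal.ofReal_ne_top measure_ball_lt_top.ne) hνu)
  refine ⟨K.toNNReal, fun g hg => ?_⟩
  rw [ENNReal.coe_toNNReal hKtop]
  set G := ∫⁻ y in 𝔹, g y ^ p with hG
  set M : 𝔼 → ℝ → ℝ≥0∞ := fun x t => ∫⁻ y in 𝔹, g ((1 - t) • x + t • y) ^ p with hM
  have hMm : Measurable (Function.uncurry M) := by
    have : Measurable fun z : (𝔼 × ℝ) × 𝔼 => g ((1 - z.1.2) • z.1.1 + z.1.2 • z.2) ^ p := by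
      fun_prop
    exact this.lintegral_prod_right'
  have hMx : ∀ x, Measurable (M x) := fun x => hMm.comp (measurable_const.prodMk measurable_id)
  have hpoint : ∀ x ∈ 𝔹, segmentPotential g x ^ r ≤
      volume 𝔹 ^ (r * (1 - p⁻¹)) * G ^ (r / p - 1) * (ν univ ^ (r - 1) * ∫⁻ t, M x t ∂ν) := by
    intro x hx
    have h1 : segmentPotential g x ≤
        volume 𝔹 ^ (1 - p⁻¹) * G ^ (p⁻¹ - r⁻¹) * ∫⁻ t, M x t ^ r⁻¹ ∂ν := by
      rw [hν, lintegral_withDensity_eq_lintegral_mul _ (by fun_prop) ((hMx x).pow_const _),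
        ← lintegral_const_mul _ (by have := (hMx x).pow_const r⁻¹; fun_prop)]
      refine setLIntegral_mono' measurableSet_Ioo fun t ht => ?_
      refine (lintegral_ball_segment_le_rpow hg hp x t).trans ?_
      rw [mul_assoc]
      gcongr
      have h2 : M x t ^ p⁻¹ = M x t ^ (p⁻¹ - r⁻¹) * M x t ^ r⁻¹ := by
        rw [← ENNReal.rpow_add_of_nonneg _ _ hpr' (by positivity), sub_add_cancel]
      change M x t ^ p⁻¹ ≤ _
      rw [h2, Pi.mul_apply, ← mul_assoc]
      gcongr
      refine (ENNReal.rpow_le_rpow (lintegral_ball_segment_le (h := fun y => g y ^ p)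
        (by fun_prop) hx ht.1 ht.2.le) hpr').trans_eq ?_
      rw [ENNReal.mul_rpow_of_nonneg _ _ hpr', ofReal_inv_pow_rpow ht.1, mul_comm]
    refine (ENNReal.rpow_le_rpow h1 (by linarith)).trans ?_
    rw [ENNReal.mul_rpow_of_nonneg _ _ (by linarith), ENNReal.mul_rpow_of_nonneg _ _ (by linarith),
      ← ENNReal.rpow_mul, ← ENNReal.rpow_mul]
    have e1 : (1 - p⁻¹) * r = r * (1 - p⁻¹) := mul_comm _ _
    have e2 : (p⁻¹ - r⁻¹) * r = r / p - 1 := by field_simp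
    rw [e1, e2]
    gcongr
    refine (rpow_lintegral_le ν hr ((hMx x).pow_const _).aemeasurable).trans_eq ?_
    simp only [← ENNReal.rpow_mul, inv_mul_cancel₀ (by linarith : r ≠ 0), ENNReal.rpow_one]
  refine (setLIntegral_mono' Metric.isOpen_ball.measurableSet hpoint).trans ?_
  have hMi : Measurable fun x => ∫⁻ t, M x t ∂ν := hMm.lintegral_prod_right'
  rw [lintegral_const_mul _ (by fun_prop), lintegral_const_mul _ hMi,
    lintegral_lintegral_swap hMm.aemeasurable]
  have h3 : ∫⁻ t, (∫⁻ x in 𝔹, M x t) ∂ν ≤ ENNReal.ofReal (2 ^ d) * G * volume 𝔹 * ν univ := by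
    rw [← lintegral_const]
    refine lintegral_mono_ae (hνac.mono fun t ht => ?_)
    exact lintegral_lintegral_ball_segment_le (h := fun y => g y ^ p) (by fun_prop) ht.1 ht.2
  have h4 : G ^ (r / p) = G ^ (r / p - 1) * G := by
    have : 0 ≤ r / p - 1 := by
      rw [sub_nonneg, one_le_div (by linarith)]
      exact hpr.le
    nth_rw 3 [← ENNReal.rpow_one G]
    rw [← ENNReal.rpow_add_of_nonneg _ _ this zero_le_one, sub_add_cancel]
  rw [h4, hK]
  calc _ ≤ volume 𝔹 ^ (r * (1 - p⁻¹)) * G ^ (r / p - 1) * (ν univ ^ (r - 1) *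
        (ENNReal.ofReal (2 ^ d) * G * volume 𝔹 * ν univ)) := mul_le_mul_right (mul_le_mul_right h3 _) _
    _ = _ := by ring

end Sobolev

/-! ### The embedding `W^{1,p} ⊆ L^r` on the unit ball -/

section SobolevStep

open Set
open scoped ENNReal NNReal

variable {d : ℕ}

local notation "𝔼" => EuclideanSpace ℝ (Fin d)
local notation "𝔹" => Metric.ball (0 : EuclideanSpace ℝ (Fin d)) 1

theorem measurable_segmentPotential {g : 𝔼 → ℝ≥0∞} (hg : Measurable g) :
    Measurable (segmentPotential g) := by
  have h : Measurable fun z : (𝔼 × ℝ) × 𝔼 => g ((1 - z.1.2) • z.1.1 + z.1.2 • z.2) := by fun_prop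
  have h2 : Measurable fun z : 𝔼 × ℝ => ∫⁻ y in 𝔹, g ((1 - z.2) • z.1 + z.2 • y) :=
    h.lintegral_prod_right'
  exact h2.lintegral_prod_right'

theorem eLpNorm_segmentPotential_le {p r : ℝ≥0∞} (hp : 1 < p) (hpr : p < r)
    (hd : d * (p.toReal⁻¹ - r.toReal⁻¹) < 1) :
    ∃ C : ℝ≥0, ∀ g : 𝔼 → ℝ≥0∞, Measurable g →
      eLpNorm (segmentPotential g) r (volume.restrict 𝔹) ≤ C * eLpNorm g p (volume.restrict 𝔹) := by
  have hp0 : p ≠ 0 := (zero_lt_one.trans hp).ne'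
  have hpt : p ≠ ⊤ := (lt_top_of_lt hpr).ne
  have hp' : 1 < p.toReal := by
    rwa [← ENNReal.toReal_one, ENNReal.toReal_lt_toReal ENNReal.one_ne_top hpt]
  by_cases hr : r = ⊤
  · subst hr
    obtain ⟨C, hC⟩ := segmentPotential_le_of_lt (d := d) hp' (by simpa using hd)
    refine ⟨C, fun g hg => ?_⟩
    rw [eLpNorm_exponent_top]
    refine eLpNormEssSup_le_of_ae_enorm_bound ?_
    filter_upwards [ae_restrict_mem Metric.isOpen_ball.measurableSet] with x hx
    rw [eLpNorm_eq_lintegral_rpow_enorm_toReal hp0 hpt, one_div]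
    exact hC g hg x hx
  · have hr0 : r ≠ 0 := (zero_lt_one.trans (hp.trans hpr)).ne'
    have hpr' : p.toReal < r.toReal := (ENNReal.toReal_lt_toReal hpt hr).2 hpr
    obtain ⟨C, hC⟩ := lintegral_segmentPotential_rpow_le (d := d) hp' hpr' hd
    refine ⟨C ^ (r.toReal)⁻¹, fun g hg => ?_⟩
    rw [eLpNorm_eq_lintegral_rpow_enorm_toReal hp0 hpt,
      eLpNorm_eq_lintegral_rpow_enorm_toReal hr0 hr]
    refine (ENNReal.rpow_le_rpow (hC g hg) (by positivity)).trans_eq ?_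
    rw [ENNReal.mul_rpow_of_nonneg _ _ (by positivity), ← ENNReal.rpow_mul, one_div,
      ENNReal.coe_rpow_of_nonneg _ (by positivity)]
    congr 2
    have : r.toReal ≠ 0 := by linarith
    field_simp

variable {V : Type*} [NormedAddCommGroup V] [NormedSpace ℝ V] [CompleteSpace V]

/-- The fundamental theorem of calculus on `[x, y]`, integrated over `y` in the ball; the factor 2
bounds `‖y - x‖`. -/
theorem enorm_mul_volume_le {w : 𝔼 → V} (hw : ContDiff ℝ 1 w) {x : 𝔼} (hx : x ∈ 𝔹) :
    ‖w x‖ₑ * volume 𝔹 ≤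
      (∫⁻ y in 𝔹, ‖w y‖ₑ) + 2 * segmentPotential (fun z => ‖fderiv ℝ w z‖ₑ) x := by
  have hcont : Continuous (fderiv ℝ w) := hw.continuous_fderiv (by simp)
  have hpt : ∀ y ∈ 𝔹, ‖w x‖ₑ ≤
      ‖w y‖ₑ + 2 * ∫⁻ t in Ioo (0 : ℝ) 1, ‖fderiv ℝ w ((1 - t) • x + t • y)‖ₑ := by
    intro y hy
    have hder : ∀ t ∈ uIcc (0 : ℝ) 1, HasDerivAt (fun t : ℝ => w ((1 - t) • x + t • y))
        (fderiv ℝ w ((1 - t) • x + t • y) (y - x)) t := by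
      intro t _
      have h1 : HasDerivAt (fun t : ℝ => (1 - t) • x + t • y) (y - x) t := by
        have := (((hasDerivAt_id t).const_sub 1).smul_const x).add
          ((hasDerivAt_id t).smul_const y)
        exact this.congr_deriv (by module)
      exact ((hw.differentiable (by simp)) _).hasFDerivAt.comp_hasDerivAt t h1
    have hFTC := intervalIntegral.integral_eq_sub_of_hasDerivAt hder
      (Continuous.intervalIntegrable (by fun_prop) _ _)
    simp only [sub_self, zero_smul, one_smul, zero_add, sub_zero, add_zero] at hFTC
    rw [intervalIntegral.integral_of_le zero_le_one, integral_Ioc_eq_integral_Ioo] at hFTC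
    have hxy : ‖y - x‖ₑ ≤ 2 := by
      have h2 : (2 : ℝ≥0∞) = ENNReal.ofReal 2 := by simp
      rw [← ofReal_norm]
      refine (ENNReal.ofReal_le_ofReal ((norm_sub_le _ _).trans ?_)).trans_eq h2.symm
      rw [mem_ball_zero_iff] at hx hy
      linarith
    calc ‖w x‖ₑ = ‖w y - (w y - w x)‖ₑ := by rw [sub_sub_cancel]
      _ ≤ ‖w y‖ₑ + ‖w y - w x‖ₑ := enorm_sub_le
      _ ≤ _ := by
        gcongr
        rw [← hFTC, ← lintegral_const_mul _ (by fun_prop)]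
        refine (enorm_integral_le_lintegral_enorm _).trans (lintegral_mono fun t => ?_)
        refine (ContinuousLinearMap.le_opENorm _ _).trans ?_
        rw [mul_comm]
        gcongr
  rw [← setLIntegral_const]
  refine (setLIntegral_mono' Metric.isOpen_ball.measurableSet hpt).trans_eq ?_
  have hm : Measurable fun z : 𝔼 × ℝ => ‖fderiv ℝ w ((1 - z.2) • x + z.2 • z.1)‖ₑ := by
    have : Continuous fun z : 𝔼 × ℝ => fderiv ℝ w ((1 - z.2) • x + z.2 • z.1) := by fun_prop
    exact this.enorm.measurable
  rw [lintegral_add_left hw.continuous.enorm.measurable,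
    lintegral_const_mul _ hm.lintegral_prod_right', segmentPotential,
    lintegral_lintegral_swap hm.aemeasurable]

/-- A (non-sharp) Sobolev embedding `W^{1,p} ⊆ L^r` on the unit ball for `1/p - 1/r < 1/d`. -/
theorem eLpNorm_le_eLpNorm_fderiv {p r : ℝ≥0∞} (hp : 1 < p) (hpr : p < r)
    (hd : d * (p.toReal⁻¹ - r.toReal⁻¹) < 1) :
    ∃ C : ℝ≥0, ∀ w : 𝔼 → V, ContDiff ℝ 1 w →
      eLpNorm w r (volume.restrict 𝔹) ≤
        C * (eLpNorm w p (volume.restrict 𝔹) + eLpNorm (fderiv ℝ w) p (volume.restrict 𝔹)) := by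
  obtain ⟨C, hC⟩ := eLpNorm_segmentPotential_le hp hpr hd
  have hr0 : r ≠ 0 := (zero_lt_one.trans (hp.trans hpr)).ne'
  have hv0 : volume 𝔹 ≠ 0 := (Metric.measure_ball_pos _ _ one_pos).ne'
  have hvt : volume 𝔹 ≠ ⊤ := measure_ball_lt_top.ne
  have hμ : volume.restrict 𝔹 ≠ 0 := by
    rwa [Ne, Measure.restrict_eq_zero]
  set μ := volume.restrict 𝔹 with hμdef
  have hμu : μ univ = volume 𝔹 := Measure.restrict_apply_univ _
  set K : ℝ≥0∞ := (volume 𝔹)⁻¹ *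
    (volume 𝔹 ^ (1 / (1 : ℝ≥0∞).toReal - 1 / p.toReal) * volume 𝔹 ^ (1 / r.toReal) + 2 * C) with hK
  have hKt : K ≠ ⊤ := by
    refine ENNReal.mul_ne_top (ENNReal.inv_ne_top.2 hv0) (ENNReal.add_ne_top.2
      ⟨ENNReal.mul_ne_top ?_ ?_, ENNReal.mul_ne_top (by simp) (by simp)⟩)
    · exact ENNReal.rpow_ne_top_of_ne_zero hv0 hvt
    · exact ENNReal.rpow_ne_top_of_ne_zero hv0 hvt
  refine ⟨K.toNNReal, fun w hw => ?_⟩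
  rw [ENNReal.coe_toNNReal hKt]
  have hgm : Measurable fun z => ‖fderiv ℝ w z‖ₑ :=
    (hw.continuous_fderiv (by simp)).enorm.measurable
  have hPm := measurable_segmentPotential hgm
  have hI : eLpNorm (fun _ : 𝔼 => ∫⁻ y in 𝔹, ‖w y‖ₑ) r μ ≤
      volume 𝔹 ^ (1 / (1 : ℝ≥0∞).toReal - 1 / p.toReal) * volume 𝔹 ^ (1 / r.toReal) *
        eLpNorm w p μ := by
    have h1 := eLpNorm_le_eLpNorm_mul_rpow_measure_univ (μ := μ) hp.le
      hw.continuous.aestronglyMeasurable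
    rw [eLpNorm_const _ hr0 hμ, enorm_eq_self, hμu, ← eLpNorm_one_eq_lintegral_enorm]
    rw [hμu] at h1
    calc _ ≤ _ := mul_le_mul_left h1 _
      _ = _ := by ring
  have hP : eLpNorm (fun x => 2 * segmentPotential (fun z => ‖fderiv ℝ w z‖ₑ) x) r μ ≤
      2 * C * eLpNorm (fderiv ℝ w) p μ := by
    have h1 := eLpNorm_le_mul_eLpNorm_of_ae_le_mul'' (μ := μ) (c := 2)
      (f := fun x => 2 * segmentPotential (fun z => ‖fderiv ℝ w z‖ₑ) x)
      (g := segmentPotential (fun z => ‖fderiv ℝ w z‖ₑ)) r hPm.aestronglyMeasurable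
      (Filter.Eventually.of_forall fun x => by simp)
    refine h1.trans ?_
    rw [mul_assoc]
    gcongr
    simpa only [eLpNorm_enorm] using hC _ hgm
  have hw' : ∀ᵐ x ∂μ, ‖w x‖ₑ ≤ (volume 𝔹)⁻¹ * ‖((fun _ : 𝔼 => ∫⁻ y in 𝔹, ‖w y‖ₑ) +
      fun x => 2 * segmentPotential (fun z => ‖fderiv ℝ w z‖ₑ) x) x‖ₑ := by
    filter_upwards [ae_restrict_mem Metric.isOpen_ball.measurableSet] with x hx
    rw [mul_comm, ← div_eq_mul_inv, ENNReal.le_div_iff_mul_le (Or.inl hv0) (Or.inl hvt)]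
    exact enorm_mul_volume_le hw hx
  refine (eLpNorm_le_mul_eLpNorm_of_ae_le_mul'' r ?_ hw').trans ?_
  · exact (measurable_const.add (hPm.const_mul 2)).aestronglyMeasurable
  rw [hK, mul_assoc]
  gcongr
  refine (eLpNorm_add_le aestronglyMeasurable_const (hPm.const_mul 2).aestronglyMeasurable
    (hp.trans hpr).le).trans ?_
  refine (add_le_add hI hP).trans ?_
  rw [add_mul]
  gcongr
  · exact le_self_add
  · exact le_add_self

end SobolevStep

/-! ### Mollification inside the unit ball -/

section Mollify

open Set Filter Topology
open scoped ENNReal NNReal Convolution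

variable {d : ℕ}

local notation "𝔼" => EuclideanSpace ℝ (Fin d)
local notation "𝔹" => Metric.ball (0 : EuclideanSpace ℝ (Fin d)) 1

theorem tsupport_listDeriv_subset {V : Type*} [NormedAddCommGroup V] [NormedSpace ℝ V]
    {φ : 𝔼 → V} (hφ : ContDiff ℝ ∞ φ) (l : List (Fin d)) :
    tsupport (listDeriv l φ) ⊆ tsupport φ := by
  induction l with
  | nil => rfl
  | cons i l ih =>
    have h : listDeriv (i :: l) φ =
        fun x => fderiv ℝ (listDeriv l φ) x (EuclideanSpace.single i 1) :=
      funext fun x => ((contDiff_listDeriv hφ l).differentiable (by simp)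
        x).lineDeriv_eq_fderiv
    rw [h]
    exact (tsupport_fderiv_apply_subset ℝ _).trans ih

theorem hasCompactSupport_listDeriv {V : Type*} [NormedAddCommGroup V] [NormedSpace ℝ V]
    {φ : 𝔼 → V} (hφ : ContDiff ℝ ∞ φ) (hc : HasCompactSupport φ) (l : List (Fin d)) :
    HasCompactSupport (listDeriv l φ) :=
  hc.of_isClosed_subset (isClosed_tsupport _) (tsupport_listDeriv_subset hφ l)

theorem listDeriv_convolution {f : 𝔼 → ℂ} (hf : LocallyIntegrable f) {φ : 𝔼 → ℝ}
    (hφ : ContDiff ℝ ∞ φ) (hc : HasCompactSupport φ) (l : List (Fin d)) :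
    listDeriv l (f ⋆[(ContinuousLinearMap.lsmul ℝ ℝ).flip] φ) =
      f ⋆[(ContinuousLinearMap.lsmul ℝ ℝ).flip] listDeriv l φ := by
  induction l with
  | nil => rfl
  | cons i l ih =>
    change (fun x => lineDeriv ℝ (listDeriv l _) x _) = _
    have hs := contDiff_listDeriv hφ l
    have hcs := hasCompactSupport_listDeriv hφ hc l
    rw [ih]
    funext x
    rw [((hcs.hasFDerivAt_convolution_right _ hf (hs.of_le (by simp)) x).hasLineDerivAt _).lineDeriv,
      convolution_precompR_apply _ hf (hcs.fderiv ℝ) (hs.continuous_fderiv (by simp))]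
    congr 1
    funext y
    exact ((hs.differentiable (by simp)) y).lineDeriv_eq_fderiv.symm

/-- The mollification of `f` by `φ`, precomposed with the dilation by `1 - φ.rOut`, so that its
values on the unit ball only depend on the values of `f` there. -/
def mollify (φ : ContDiffBump (0 : 𝔼)) (f : 𝔼 → ℂ) (x : 𝔼) : ℂ :=
  ∫ t, φ.normed volume ((1 - φ.rOut) • x - t) • f t

theorem mollify_eq_convolution (φ : ContDiffBump (0 : 𝔼)) (f : 𝔼 → ℂ) (x : 𝔼) :
    mollify φ f x =
      (f ⋆[(ContinuousLinearMap.lsmul ℝ ℝ).flip] φ.normed volume) (0 + (1 - φ.rOut) • x) := by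
  rw [zero_add]
  rfl

theorem contDiff_mollify (φ : ContDiffBump (0 : 𝔼)) {f : 𝔼 → ℂ} (hf : LocallyIntegrable f) :
    ContDiff ℝ ∞ (mollify φ f) := by
  rw [funext (mollify_eq_convolution φ f)]
  exact (φ.hasCompactSupport_normed.contDiff_convolution_right _ hf φ.contDiff_normed).comp
    (by fun_prop)

/-- The dilation is what makes the reflected bump an admissible test function: it is supported
within `φ.rOut` of `(1 - φ.rOut) x`, hence inside the open ball. The power of `1 - φ.rOut` is the
chain rule. -/
theorem listDeriv_mollify (φ : ContDiffBump (0 : 𝔼)) (hφ : φ.rOut < 1) {α : Fin d → ℕ}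
    {f g : 𝔼 → ℂ} (hfg : IsWeakDeriv 𝔹 α f g) (hf : LocallyIntegrable (indicator 𝔹 f))
    {x : 𝔼} (hx : x ∈ 𝔹) :
    listDeriv (indexList α) (mollify φ (indicator 𝔹 f)) x =
      (1 - φ.rOut) ^ (∑ i, α i) • mollify φ (indicator 𝔹 g) x := by
  have hB : MeasurableSet 𝔹 := Metric.isOpen_ball.measurableSet
  have hcd : ContDiff ℝ ∞ (φ.normed volume) := φ.contDiff_normed
  have hcs : HasCompactSupport (φ.normed (volume : Measure 𝔼)) := φ.hasCompactSupport_normed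
  rw [funext (mollify_eq_convolution φ _), listDeriv_comp_affine
    (hcs.contDiff_convolution_right _ hf hcd), listDeriv_convolution hf hcd hcs,
    length_indexList]
  congr 1
  set z := (1 - φ.rOut) • x with hz
  rw [zero_add]
  change ∫ t, listDeriv (indexList α) (φ.normed volume) (z - t) • indicator 𝔹 f t =
    ∫ t, φ.normed volume (z - t) • indicator 𝔹 g t
  set τ : 𝔼 → ℝ := fun t => φ.normed volume (z + (-1 : ℝ) • t) with hτ
  have hτ1 : ContDiff ℝ ∞ τ := hcd.comp (by fun_prop)
  have hsub : tsupport τ ⊆ Metric.closedBall z φ.rOut := by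
    refine closure_minimal (fun t ht => ?_) Metric.isClosed_closedBall
    have : z + (-1 : ℝ) • t ∈ Function.support (φ.normed (volume : Measure 𝔼)) := ht
    rw [φ.support_normed_eq, mem_ball_zero_iff] at this
    rw [mem_closedBall_iff_norm']
    refine le_of_eq_of_le (congrArg _ ?_) this.le
    module
  have hsubB : Metric.closedBall z φ.rOut ⊆ 𝔹 := by
    intro t ht
    rw [mem_ball_zero_iff] at hx ⊢
    rw [mem_closedBall_iff_norm] at ht
    have h1 : ‖z‖ < 1 - φ.rOut := by
      rw [hz, norm_smul, Real.norm_of_nonneg (by linarith)]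
      nlinarith
    linarith [norm_le_norm_add_norm_sub' t z]
  have h := hfg.2.2 τ hτ1 ((isCompact_closedBall _ _).of_isClosed_subset (isClosed_tsupport _) hsub)
    (hsub.trans hsubB)
  have e : ∀ t, z + (-1 : ℝ) • t = z - t := fun t => by module
  have h2 : ∀ t, multiDeriv α τ t =
      (-1) ^ (∑ i, α i) * listDeriv (indexList α) (φ.normed volume) (z - t) := by
    intro t
    rw [multiDeriv_eq_listDeriv, hτ, listDeriv_comp_affine hcd, length_indexList, e, smul_eq_mul]
  have h3 : ∀ (ψ : 𝔼 → ℝ) (k : 𝔼 → ℂ),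
      ∫ t, ψ t • indicator 𝔹 k t = ∫ t in 𝔹, ψ t • k t := by
    intro ψ k
    rw [← integral_indicator hB]
    congr 1
    funext t
    by_cases ht : t ∈ 𝔹 <;> simp [ht]
  rw [h3, h3]
  simp only [h2, mul_smul, integral_smul] at h
  -- The sign from differentiating the reflected bump equals the sign in the definition of the weak
  -- derivative, so both cancel.
  have h4 : ((-1 : ℝ) ^ (∑ i, α i)) ≠ 0 := by simp
  refine smul_right_injective ℂ h4 ?_
  change ((-1 : ℝ) ^ (∑ i, α i)) • _ = ((-1 : ℝ) ^ (∑ i, α i)) • _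
  rw [h, Complex.real_smul]
  simp only [hτ, e]
  push_cast
  rfl

/-- Jensen for the probability measure with density `φ.normed (z - t)`. -/
theorem enorm_mollify_rpow_le (φ : ContDiffBump (0 : 𝔼)) {f : 𝔼 → ℂ}
    (hf : AEStronglyMeasurable f) (x : 𝔼) :
    ‖mollify φ f x‖ₑ ^ (2 : ℝ) ≤ ∫⁻ t,
      ENNReal.ofReal (φ.normed volume ((1 - φ.rOut) • x - t)) * ‖f t‖ₑ ^ (2 : ℝ) := by
  have hcd : Continuous (φ.normed (volume : Measure 𝔼)) := φ.continuous_normed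
  set z := (1 - φ.rOut) • x
  set ν := (volume : Measure 𝔼).withDensity
    fun t => ENNReal.ofReal (φ.normed volume (z - t)) with hν
  have hdens : Measurable fun t => ENNReal.ofReal (φ.normed volume (z - t)) := by fun_prop
  have hν1 : ν univ = 1 := by
    rw [hν, withDensity_apply _ MeasurableSet.univ, Measure.restrict_univ,
      ← ofReal_integral_eq_lintegral_ofReal, integral_sub_left_eq_self, φ.integral_normed,
      ENNReal.ofReal_one]
    · exact φ.integrable_normed.comp_sub_left z
    · exact Eventually.of_forall fun t => φ.nonneg_normed _
  have hac : ν ≪ volume := withDensity_absolutelyContinuous _ _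
  have h1 : ‖mollify φ f x‖ₑ ≤ ∫⁻ t, ‖f t‖ₑ ∂ν := by
    rw [hν, lintegral_withDensity_eq_lintegral_mul₀ hdens.aemeasurable hf.enorm]
    refine (enorm_integral_le_lintegral_enorm _).trans_eq (lintegral_congr fun t => ?_)
    rw [enorm_smul, Real.enorm_of_nonneg (φ.nonneg_normed _), Pi.mul_apply]
  refine (ENNReal.rpow_le_rpow h1 (by norm_num)).trans ?_
  refine (rpow_lintegral_le ν one_lt_two (hf.enorm.mono_ac hac)).trans_eq ?_
  rw [hν1, ENNReal.one_rpow, one_mul, hν,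
    lintegral_withDensity_eq_lintegral_mul₀ hdens.aemeasurable (hf.enorm.pow_const _)]
  rfl

theorem eLpNorm_two_rpow {X F : Type*} [MeasurableSpace X] [NormedAddCommGroup F] {μ : Measure X}
    (f : X → F) : eLpNorm f 2 μ ^ (2 : ℝ) = ∫⁻ x, ‖f x‖ₑ ^ (2 : ℝ) ∂μ := by
  rw [eLpNorm_eq_lintegral_rpow_enorm_toReal (by simp) (by simp), ← ENNReal.rpow_mul]
  simp

/-- After Fubini, the integral of the dilated bump in `x` is `(1 - φ.rOut)^(-d)`, at most `2^d`
uniformly in `φ`. This uniformity is what the density argument needs. -/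
theorem eLpNorm_mollify_le (φ : ContDiffBump (0 : 𝔼)) (hφ : φ.rOut ≤ 1 / 2) {f : 𝔼 → ℂ}
    (hf : AEStronglyMeasurable f) :
    eLpNorm (mollify φ f) 2 volume ≤ ENNReal.ofReal (2 ^ d) ^ (1 / 2 : ℝ) * eLpNorm f 2 volume := by
  have hcd : Continuous (φ.normed (volume : Measure 𝔼)) := φ.continuous_normed
  have h2 : (0 : ℝ) < 2 := two_pos
  rw [← ENNReal.rpow_le_rpow_iff h2, ENNReal.mul_rpow_of_nonneg _ _ h2.le, eLpNorm_two_rpow,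
    eLpNorm_two_rpow, ← ENNReal.rpow_mul, one_div_mul_cancel h2.ne', ENNReal.rpow_one]
  refine (lintegral_mono fun x => enorm_mollify_rpow_le φ hf x).trans ?_
  have hfe : AEMeasurable (fun t => ‖f t‖ₑ ^ (2 : ℝ)) := hf.enorm.pow_const _
  rw [lintegral_lintegral_swap, ← lintegral_const_mul'' _ hfe]
  · refine lintegral_mono fun t => ?_
    rw [lintegral_mul_const _ (by fun_prop)]
    gcongr
    have h3 := lintegral_comp_affine (h := fun y : 𝔼 => ENNReal.ofReal (φ.normed volume y))
      (by fun_prop) (-t) (t := 1 - φ.rOut) (by linarith)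
    rw [← ofReal_integral_eq_lintegral_ofReal φ.integrable_normed
      (Eventually.of_forall fun t => φ.nonneg_normed _), φ.integral_normed, ENNReal.ofReal_one,
      mul_one] at h3
    simp only [neg_add_eq_sub] at h3
    rw [h3]
    have hpos : 0 < 1 - φ.rOut := by linarith
    gcongr
    rw [inv_le_comm₀ hpos two_pos]
    linarith
  · refine AEMeasurable.mul ?_ ?_
    · exact (by fun_prop : Measurable fun p : 𝔼 × 𝔼 =>
        ENNReal.ofReal (φ.normed volume ((1 - φ.rOut) • p.1 - p.2))).aemeasurable
    · exact hfe.comp_quasiMeasurePreserving Measure.quasiMeasurePreserving_snd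

theorem integrable_mollify_integrand (φ : ContDiffBump (0 : 𝔼)) {f : 𝔼 → ℂ}
    (hf : LocallyIntegrable f) (x : 𝔼) :
    Integrable fun t => φ.normed volume ((1 - φ.rOut) • x - t) • f t :=
  φ.hasCompactSupport_normed.convolutionExists_right (ContinuousLinearMap.lsmul ℝ ℝ).flip hf
    φ.continuous_normed ((1 - φ.rOut) • x)

theorem mollify_sub (φ : ContDiffBump (0 : 𝔼)) {f g : 𝔼 → ℂ} (hf : LocallyIntegrable f)
    (hg : LocallyIntegrable g) : mollify φ (f - g) = mollify φ f - mollify φ g := by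
  funext x
  simp only [mollify, Pi.sub_apply, smul_sub]
  exact integral_sub (integrable_mollify_integrand φ hf x) (integrable_mollify_integrand φ hg x)

/-- One `η` pays for averaging near the dilated point `z`, the other for the displacement from `z`
to `x`; both distances are less than `2 * φ.rOut`. -/
theorem dist_mollify_le (φ : ContDiffBump (0 : 𝔼)) {k : 𝔼 → ℂ}
    (hk : Continuous k) {η δ : ℝ} (hδ : 2 * φ.rOut ≤ δ)
    (hu : ∀ y z, dist y z < δ → dist (k y) (k z) ≤ η) {x : 𝔼} (hx : x ∈ 𝔹) :
    dist (mollify φ k x) (k x) ≤ η + η := by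
  set z := (1 - φ.rOut) • x with hz
  have hpos := φ.rOut_pos
  have h1 : dist (mollify φ k x) (k z) ≤ η := by
    have h := φ.dist_normed_convolution_le (μ := (volume : Measure 𝔼)) (x₀ := z) (ε := η)
      hk.aestronglyMeasurable fun y hy => hu _ _ (by
        rw [Metric.mem_ball] at hy
        linarith)
    rwa [← convolution_flip] at h
  have h2 : dist (k z) (k x) ≤ η := by
    refine hu _ _ ?_
    rw [dist_eq_norm, hz, sub_smul, one_smul, sub_sub_cancel_left, norm_neg, norm_smul,
      Real.norm_of_nonneg hpos.le]
    rw [mem_ball_zero_iff] at hx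
    nlinarith
  exact (dist_triangle _ (k z) _).trans (add_le_add h1 h2)

/-- Density of compactly supported continuous functions in `L²`: for those, uniform continuity gives
uniform convergence on the ball, and the remainder is controlled by the uniform `L²` bound of
mollification. -/
theorem tendsto_eLpNorm_mollify_sub {φ : ℕ → ContDiffBump (0 : 𝔼)}
    (hφ : Tendsto (fun n => (φ n).rOut) atTop (𝓝 0)) {f : 𝔼 → ℂ} (hf : MemLp f 2 volume) :
    Tendsto (fun n => eLpNorm (mollify (φ n) f - f) 2 (volume.restrict 𝔹)) atTop (𝓝 0) := by
  rw [ENNReal.tendsto_nhds_zero]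
  intro ε hε
  have hfl : LocallyIntegrable f := hf.locallyIntegrable (by norm_num)
  set M : ℝ≥0∞ := ENNReal.ofReal (2 ^ d) ^ (1 / 2 : ℝ) with hM
  have hMt : M ≠ ⊤ := ENNReal.rpow_ne_top_of_nonneg (by norm_num) ENNReal.ofReal_ne_top
  obtain ⟨δ, hδ, hδε⟩ : ∃ δ : ℝ≥0∞, δ ≠ 0 ∧ M * δ + δ ≤ ε / 2 := by
    refine ⟨(ε / 2) / (M + 1), ?_, ?_⟩
    · exact (ENNReal.div_pos (ENNReal.half_pos hε.ne').ne' (by simp [hMt])).ne'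
    · rw [← add_one_mul]
      exact ENNReal.mul_div_le
  obtain ⟨k, hkc, hkf, hkcont, hkL⟩ := hf.exists_hasCompactSupport_eLpNorm_sub_le (by simp) hδ
  set v : ℝ≥0∞ := volume 𝔹 ^ (1 / 2 : ℝ) with hv
  have hvt : v ≠ ⊤ := ENNReal.rpow_ne_top_of_nonneg (by norm_num) measure_ball_lt_top.ne
  obtain ⟨η, hη, hηε⟩ : ∃ η : ℝ, 0 < η ∧ ENNReal.ofReal (η + η) * v ≤ ε / 2 := by
    have : Tendsto (fun η : ℝ => ENNReal.ofReal (η + η) * v) (𝓝[>] 0) (𝓝 0) := by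
      have h1 : Tendsto (fun η : ℝ => ENNReal.ofReal (η + η)) (𝓝 0) (𝓝 0) := by
        have : Continuous fun η : ℝ => ENNReal.ofReal (η + η) :=
          ENNReal.continuous_ofReal.comp (by fun_prop)
        simpa using this.tendsto 0
      simpa using (ENNReal.Tendsto.mul_const h1 (Or.inr hvt)).mono_left nhdsWithin_le_nhds
    obtain ⟨η, h1, h2⟩ := ((ENNReal.tendsto_nhds_zero.1 this (ε / 2)
      (ENNReal.half_pos hε.ne')).and self_mem_nhdsWithin).exists
    exact ⟨η, h2, h1⟩
  obtain ⟨δ', hδ', hu⟩ := Metric.uniformContinuous_iff.1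
    (hkc.uniformContinuous_of_continuous hkcont) η hη
  have hev : ∀ᶠ n in atTop, (φ n).rOut < min (1 / 2) (δ' / 2) :=
    hφ.eventually_lt_const (by positivity)
  filter_upwards [hev] with n hn
  have hn1 : (φ n).rOut ≤ 1 / 2 := (hn.trans_le (min_le_left _ _)).le
  have hn2 : 2 * (φ n).rOut ≤ δ' := by linarith [hn.trans_le (min_le_right _ _)]
  have hkl : LocallyIntegrable k := hkcont.locallyIntegrable
  have hdec : mollify (φ n) f - f =
      (mollify (φ n) (f - k) - (f - k)) + (mollify (φ n) k - k) := by
    rw [mollify_sub _ hfl hkl]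
    abel
  have hm1 : AEStronglyMeasurable (mollify (φ n) (f - k)) (volume.restrict 𝔹) :=
    (contDiff_mollify _ (hfl.sub hkl)).continuous.aestronglyMeasurable
  have hm2 : AEStronglyMeasurable (mollify (φ n) k) (volume.restrict 𝔹) :=
    (contDiff_mollify _ hkl).continuous.aestronglyMeasurable
  have hfk : AEStronglyMeasurable (f - k) volume := hf.1.sub hkcont.aestronglyMeasurable
  have b1 : eLpNorm (mollify (φ n) (f - k) - (f - k)) 2 (volume.restrict 𝔹) ≤ ε / 2 := by
    refine (eLpNorm_sub_le hm1 hfk.restrict (by norm_num)).trans (le_trans ?_ hδε)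
    gcongr
    · refine (eLpNorm_mono_measure _ Measure.restrict_le_self).trans
        ((eLpNorm_mollify_le _ hn1 hfk).trans ?_)
      gcongr
    · exact (eLpNorm_mono_measure _ Measure.restrict_le_self).trans hkf
  have b2 : eLpNorm (mollify (φ n) k - k) 2 (volume.restrict 𝔹) ≤ ε / 2 := by
    refine le_trans ?_ hηε
    refine (eLpNorm_le_of_ae_bound (C := η + η) ?_).trans_eq ?_
    · filter_upwards [ae_restrict_mem Metric.isOpen_ball.measurableSet] with x hx
      have := dist_mollify_le (φ n) hkcont hn2
        (fun y z h => (hu h).le) hx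
      rwa [dist_eq_norm] at this
    · rw [Measure.restrict_apply_univ, mul_comm, hv]
      simp
  rw [hdec]
  refine (eLpNorm_add_le (hm1.sub hfk.restrict) (hm2.sub hkcont.aestronglyMeasurable)
    (by norm_num)).trans ((add_le_add b1 b2).trans_eq (ENNReal.add_halves ε))

end Mollify

/-! ### Weak derivatives and smooth approximation -/

section Approximation

open Set Filter Topology
open scoped ENNReal NNReal

variable {d : ℕ}

local notation "𝔼" => EuclideanSpace ℝ (Fin d)
local notation "𝔹" => Metric.ball (0 : EuclideanSpace ℝ (Fin d)) 1

theorem mem_multiIndices {m : ℕ} {α : Fin d → ℕ} : α ∈ multiIndices d m ↔ ∑ i, α i ≤ m := by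
  simp [multiIndices]

theorem integrableOn_smul_of_tsupport_subset {Ω : Set 𝔼} {φ : 𝔼 → ℝ} (hφ : Continuous φ)
    (hc : HasCompactSupport φ) (hs : tsupport φ ⊆ Ω) {g : 𝔼 → ℂ} (hg : LocallyIntegrableOn g Ω) :
    IntegrableOn (fun x => φ x • g x) Ω := by
  have h1 : IntegrableOn g (tsupport φ) := hg.integrableOn_compact_subset hs hc
  have h2 : IntegrableOn (fun x => φ x • g x) (tsupport φ) :=
    h1.continuousOn_smul hφ.continuousOn hc
  refine ((integrableOn_iff_integrable_of_support_subset ?_).1 h2).integrableOn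
  exact (Function.support_smul_subset_left φ g).trans (subset_tsupport φ)

theorem multiDeriv_test {φ : 𝔼 → ℝ} {Ω : Set 𝔼} (hφ : ContDiff ℝ ∞ φ) (hc : HasCompactSupport φ)
    (hs : tsupport φ ⊆ Ω) (α : Fin d → ℕ) :
    ContDiff ℝ ∞ (multiDeriv α φ) ∧ HasCompactSupport (multiDeriv α φ) ∧
      tsupport (multiDeriv α φ) ⊆ Ω := by
  rw [multiDeriv_eq_listDeriv]
  exact ⟨contDiff_listDeriv hφ _, hasCompactSupport_listDeriv hφ hc _,
    (tsupport_listDeriv_subset hφ _).trans hs⟩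

theorem IsWeakDeriv.ae_eq {Ω : Set 𝔼} (hΩ : IsOpen Ω) {α : Fin d → ℕ} {f g g' : 𝔼 → ℂ}
    (h : IsWeakDeriv Ω α f g) (h' : IsWeakDeriv Ω α f g') : g =ᵐ[volume.restrict Ω] g' := by
  have h0 := hΩ.ae_eq_zero_of_integral_contDiff_smul_eq_zero (h.2.1.sub h'.2.1)
    fun φ hφ hc hs => ?_
  · rw [Filter.EventuallyEq, ae_restrict_iff' hΩ.measurableSet]
    exact h0.mono fun x hx hxΩ => sub_eq_zero.1 (hx hxΩ)
  · have e := (h.2.2 φ hφ hc hs).symm.trans (h'.2.2 φ hφ hc hs)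
    have e' := mul_left_cancel₀ (pow_ne_zero _ (by simp)) e
    rw [← setIntegral_eq_integral_of_forall_compl_eq_zero (s := Ω)]
    · simp only [Pi.sub_apply, smul_sub]
      rw [integral_sub (integrableOn_smul_of_tsupport_subset hφ.continuous hc hs h.2.1)
        (integrableOn_smul_of_tsupport_subset hφ.continuous hc hs h'.2.1), e', sub_self]
    · intro x hx
      rw [image_eq_zero_of_notMem_tsupport fun h => hx (hs h), zero_smul]

theorem IsWeakDeriv.sub {Ω : Set 𝔼} {α : Fin d → ℕ} {f g f' g' : 𝔼 → ℂ}
    (h : IsWeakDeriv Ω α f g) (h' : IsWeakDeriv Ω α f' g') :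
    IsWeakDeriv Ω α (f - f') (g - g') := by
  refine ⟨h.1.sub h'.1, h.2.1.sub h'.2.1, fun φ hφ hc hs => ?_⟩
  obtain ⟨t1, t2, t3⟩ := multiDeriv_test hφ hc hs α
  simp only [Pi.sub_apply, smul_sub]
  rw [integral_sub (integrableOn_smul_of_tsupport_subset t1.continuous t2 t3 h.1)
      (integrableOn_smul_of_tsupport_subset t1.continuous t2 t3 h'.1),
    integral_sub (integrableOn_smul_of_tsupport_subset hφ.continuous hc hs h.2.1)
      (integrableOn_smul_of_tsupport_subset hφ.continuous hc hs h'.2.1),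
    h.2.2 φ hφ hc hs, h'.2.2 φ hφ hc hs, mul_sub]

theorem indexList_zero : indexList (0 : Fin d → ℕ) = [] := by
  rw [← List.length_eq_zero_iff, length_indexList]
  simp

theorem isWeakDeriv_zero {Ω : Set 𝔼} {f : 𝔼 → ℂ} (hf : LocallyIntegrableOn f Ω) :
    IsWeakDeriv Ω 0 f f := by
  refine ⟨hf, hf, fun φ _ _ _ => ?_⟩
  rw [multiDeriv_eq_listDeriv, indexList_zero]
  simp [listDeriv]

theorem weakDeriv_ae_eq {Ω : Set 𝔼} (hΩ : IsOpen Ω) {α : Fin d → ℕ} {f g : 𝔼 → ℂ}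
    (h : IsWeakDeriv Ω α f g) : weakDeriv Ω α f =ᵐ[volume.restrict Ω] g := by
  have hex : ∃ g, IsWeakDeriv Ω α f g := ⟨g, h⟩
  rw [weakDeriv, dif_pos hex]
  exact hex.choose_spec.ae_eq hΩ h

theorem integral_listDeriv_smul {φ : 𝔼 → ℝ} (hφ : ContDiff ℝ ∞ φ) (hc : HasCompactSupport φ)
    {F : 𝔼 → ℂ} (hF : ContDiff ℝ ∞ F) (l : List (Fin d)) :
    ∫ x, listDeriv l φ x • F x = (-1) ^ l.length * ∫ x, φ x • listDeriv l F x := by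
  induction l generalizing F with
  | nil => simp [listDeriv]
  | cons i l ih =>
    have hl := contDiff_listDeriv hφ l
    have hlc := hasCompactSupport_listDeriv hφ hc l
    have hi := contDiff_listDeriv hφ (i :: l)
    have hic := hasCompactSupport_listDeriv hφ hc (i :: l)
    have hFi := contDiff_listDeriv hF [i]
    have hint : ∀ {ψ : 𝔼 → ℝ} {G : 𝔼 → ℂ}, ContDiff ℝ ∞ ψ → HasCompactSupport ψ →
        ContDiff ℝ ∞ G → Integrable fun x => ψ x • G x := fun h1 h2 h3 =>
      (h1.continuous.smul h3.continuous).integrable_of_hasCompactSupport h2.smul_right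
    have key := integral_bilinear_hasLineDerivAt_right_eq_neg_left_of_integrable
      (μ := (volume : Measure 𝔼)) (B := ContinuousLinearMap.lsmul ℝ ℝ (E := ℂ))
      (f := listDeriv l φ) (f' := listDeriv (i :: l) φ) (g := F) (g' := listDeriv [i] F)
      (v := EuclideanSpace.single i 1) (hint hi hic hF) (hint hl hlc hFi) (hint hl hlc hF)
      (fun x _ => ((hl.differentiable (by simp)) x).lineDifferentiableAt.hasLineDerivAt)
      (fun x _ => ((hF.differentiable (by simp)) x).lineDifferentiableAt.hasLineDerivAt)
    simp only [ContinuousLinearMap.lsmul_apply] at key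
    rw [← neg_eq_iff_eq_neg] at key
    -- The induction hypothesis leaves the new derivative innermost on `F`; commuting partial
    -- derivatives brings it to the front.
    rw [← key, ih hFi, ← listDeriv_append, listDeriv_perm hF List.perm_append_comm,
      List.length_cons, pow_succ]
    simp

instance isFiniteMeasure_restrict_ball : IsFiniteMeasure (volume.restrict 𝔹) :=
  isFiniteMeasure_restrict.2 measure_ball_lt_top.ne

theorem memLp_of_continuous {V : Type*} [NormedAddCommGroup V] {F : 𝔼 → V} (hF : Continuous F)
    (p : ℝ≥0∞) : MemLp F p (volume.restrict 𝔹) := by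
  obtain ⟨C, hC⟩ := (isCompact_closedBall (0 : 𝔼) 1).exists_bound_of_continuousOn hF.continuousOn
  refine MemLp.of_bound hF.aestronglyMeasurable C ?_
  filter_upwards [ae_restrict_mem Metric.isOpen_ball.measurableSet] with x hx
  exact hC x (Metric.ball_subset_closedBall hx)

theorem locallyIntegrableOn_of_memLp {f : 𝔼 → ℂ} (hf : MemLp f 2 (volume.restrict 𝔹)) :
    LocallyIntegrableOn f 𝔹 :=
  IntegrableOn.locallyIntegrableOn (hf.integrable (by norm_num))

theorem tendsto_integral_smul_of_tendsto_eLpNorm {ψ : 𝔼 → ℝ} (hψ : Continuous ψ) {F : ℕ → 𝔼 → ℂ}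
    {f : 𝔼 → ℂ} (hF : ∀ n, MemLp (F n) 2 (volume.restrict 𝔹)) (hf : MemLp f 2 (volume.restrict 𝔹))
    (h : Tendsto (fun n => eLpNorm (F n - f) 2 (volume.restrict 𝔹)) atTop (𝓝 0)) :
    Tendsto (fun n => ∫ x in 𝔹, ψ x • F n x) atTop (𝓝 (∫ x in 𝔹, ψ x • f x)) := by
  have hψ2 := memLp_of_continuous hψ 2
  have hi : ∀ {g : 𝔼 → ℂ}, MemLp g 2 (volume.restrict 𝔹) →
      Integrable (ψ • g) (volume.restrict 𝔹) := fun hg => memLp_one_iff_integrable.1 (hg.smul hψ2)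
  refine tendsto_integral_of_L1' _ (hi hf).1 (Eventually.of_forall fun n => hi (hF n)) ?_
  have h2 := ENNReal.Tendsto.const_mul (a := eLpNorm ψ 2 (volume.restrict 𝔹)) h
    (Or.inr hψ2.eLpNorm_ne_top)
  rw [mul_zero] at h2
  refine tendsto_of_tendsto_of_tendsto_of_le_of_le tendsto_const_nhds h2
    (fun _ => zero_le) fun n => ?_
  have : (fun x => ψ x • F n x) - (ψ • f) = ψ • (F n - f) := by
    rw [smul_sub]
    rfl
  change eLpNorm ((fun x => ψ x • F n x) - (ψ • f)) 1 _ ≤ _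
  rw [this]
  exact eLpNorm_smul_le_mul_eLpNorm ((hF n).1.sub hf.1) hψ2.1

/-- Weak differentiation is closed in `L²`: integrate by parts for the smooth `F n` and pass to the
limit on both sides, a fixed test function being in `L²`. -/
theorem isWeakDeriv_of_tendsto {F : ℕ → 𝔼 → ℂ} (hF : ∀ n, ContDiff ℝ ∞ (F n)) {f g : 𝔼 → ℂ}
    {α : Fin d → ℕ} (hf : MemLp f 2 (volume.restrict 𝔹)) (hg : MemLp g 2 (volume.restrict 𝔹))
    (hFf : Tendsto (fun n => eLpNorm (F n - f) 2 (volume.restrict 𝔹)) atTop (𝓝 0))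
    (hFg : Tendsto (fun n => eLpNorm (listDeriv (indexList α) (F n) - g) 2 (volume.restrict 𝔹))
      atTop (𝓝 0)) : IsWeakDeriv 𝔹 α f g := by
  refine ⟨locallyIntegrableOn_of_memLp hf, locallyIntegrableOn_of_memLp hg, fun φ hφ hc hs => ?_⟩
  obtain ⟨t1, t2, t3⟩ := multiDeriv_test hφ hc hs α
  have l1 := tendsto_integral_smul_of_tendsto_eLpNorm t1.continuous
    (fun n => memLp_of_continuous (hF n).continuous 2) hf hFf
  have l2 := (tendsto_integral_smul_of_tendsto_eLpNorm hφ.continuous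
    (fun n => memLp_of_continuous (contDiff_listDeriv (hF n) (indexList α)).continuous 2) hg
    hFg).const_mul ((-1 : ℂ) ^ ∑ i, α i)
  refine tendsto_nhds_unique (l1.congr fun n => ?_) l2
  have e : ∀ {ψ : 𝔼 → ℝ}, tsupport ψ ⊆ 𝔹 → ∀ G : 𝔼 → ℂ,
      ∫ x in 𝔹, ψ x • G x = ∫ x, ψ x • G x := fun hψ G =>
    setIntegral_eq_integral_of_forall_compl_eq_zero fun x hx => by
      rw [image_eq_zero_of_notMem_tsupport fun h => hx (hψ h), zero_smul]
  rw [e t3, e hs, multiDeriv_eq_listDeriv, integral_listDeriv_smul hφ hc (hF n), length_indexList]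

theorem tendsto_eLpNorm_of_tendsto_sub {X V : Type*} [MeasurableSpace X] [NormedAddCommGroup V]
    {μ : Measure X} {F : ℕ → X → V} {f : X → V} (hF : ∀ n, AEStronglyMeasurable (F n) μ)
    (hf : MemLp f 2 μ) (h : Tendsto (fun n => eLpNorm (F n - f) 2 μ) atTop (𝓝 0)) :
    Tendsto (fun n => eLpNorm (F n) 2 μ) atTop (𝓝 (eLpNorm f 2 μ)) := by
  have h1 : Tendsto (fun n => eLpNorm (F n - f) 2 μ + eLpNorm f 2 μ) atTop
      (𝓝 (0 + eLpNorm f 2 μ)) := h.add tendsto_const_nhds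
  have h2 : Tendsto (fun n => eLpNorm f 2 μ - eLpNorm (F n - f) 2 μ) atTop
      (𝓝 (eLpNorm f 2 μ - 0)) :=
    ENNReal.Tendsto.sub tendsto_const_nhds h (Or.inl hf.eLpNorm_ne_top)
  rw [zero_add] at h1
  rw [tsub_zero] at h2
  refine tendsto_of_tendsto_of_tendsto_of_le_of_le h2 h1 (fun n => ?_) fun n => ?_
  · rw [tsub_le_iff_right]
    calc eLpNorm f 2 μ = eLpNorm (F n - (F n - f)) 2 μ := by rw [sub_sub_cancel]
      _ ≤ _ := eLpNorm_sub_le (hF n) ((hF n).sub hf.1) (by norm_num)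
  · calc eLpNorm (F n) 2 μ = eLpNorm (F n - f + f) 2 μ := by rw [sub_add_cancel]
      _ ≤ _ := eLpNorm_add_le ((hF n).sub hf.1) hf.1 (by norm_num)

/-- The smooth functions `F n` converge to `f` in `H^m` of the unit ball. -/
structure SobolevApprox (m : ℕ) (f : 𝔼 → ℂ) (F : ℕ → 𝔼 → ℂ) : Prop where
  smooth : ∀ n, ContDiff ℝ ∞ (F n)
  tendsto : ∀ α ∈ multiIndices d m, ∃ g, IsWeakDeriv 𝔹 α f g ∧ MemLp g 2 (volume.restrict 𝔹) ∧
    Tendsto (fun n => eLpNorm (listDeriv (indexList α) (F n) - g) 2 (volume.restrict 𝔹)) atTop (𝓝 0)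

theorem SobolevApprox.memSobolev {m : ℕ} {f : 𝔼 → ℂ} {F : ℕ → 𝔼 → ℂ} (h : SobolevApprox m f F) :
    MemSobolev 𝔹 m f := fun α hα => by
  obtain ⟨g, h1, h2, -⟩ := h.tendsto α hα
  exact ⟨g, h1, h2⟩

theorem listDeriv_sub {V : Type*} [NormedAddCommGroup V] [NormedSpace ℝ V] {F G : 𝔼 → V}
    (hF : ContDiff ℝ ∞ F) (hG : ContDiff ℝ ∞ G) (l : List (Fin d)) :
    listDeriv l (F - G) = listDeriv l F - listDeriv l G := by
  funext x
  have hs : ContDiff ℝ ∞ (F - G) := hF.sub hG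
  rw [Pi.sub_apply, listDeriv_apply hs, listDeriv_apply hF, listDeriv_apply hG,
    iteratedFDeriv_sub_apply (hF.contDiffAt.of_le (by exact_mod_cast le_top))
      (hG.contDiffAt.of_le (by exact_mod_cast le_top))]
  rfl

theorem SobolevApprox.sub {m : ℕ} {f g : 𝔼 → ℂ} {F G : ℕ → 𝔼 → ℂ} (hF : SobolevApprox m f F)
    (hG : SobolevApprox m g G) : SobolevApprox m (f - g) fun n => F n - G n := by
  refine ⟨fun n => (hF.smooth n).sub (hG.smooth n), fun α hα => ?_⟩
  obtain ⟨a, a1, a2, a3⟩ := hF.tendsto α hα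
  obtain ⟨b, b1, b2, b3⟩ := hG.tendsto α hα
  refine ⟨a - b, a1.sub b1, a2.sub b2, ?_⟩
  have h := a3.add b3
  rw [add_zero] at h
  refine tendsto_of_tendsto_of_tendsto_of_le_of_le tendsto_const_nhds h (fun _ => zero_le)
    fun n => ?_
  rw [listDeriv_sub (hF.smooth n) (hG.smooth n), sub_sub_sub_comm]
  exact eLpNorm_sub_le
    ((contDiff_listDeriv (hF.smooth n) _).continuous.aestronglyMeasurable.sub a2.1)
    ((contDiff_listDeriv (hG.smooth n) _).continuous.aestronglyMeasurable.sub b2.1) (by norm_num)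

theorem MemSobolev.memLp {m : ℕ} {f : 𝔼 → ℂ} (h : MemSobolev 𝔹 m f) :
    MemLp f 2 (volume.restrict 𝔹) := by
  obtain ⟨g, h1, h2⟩ := h 0 (mem_multiIndices.2 (by simp))
  exact h2.ae_eq (h1.ae_eq Metric.isOpen_ball (isWeakDeriv_zero h1.1))

theorem SobolevApprox.tendsto_eLpNorm_sub {m : ℕ} {f : 𝔼 → ℂ} {F : ℕ → 𝔼 → ℂ}
    (h : SobolevApprox m f F) :
    Tendsto (fun n => eLpNorm (F n - f) 2 (volume.restrict 𝔹)) atTop (𝓝 0) := by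
  obtain ⟨g, h1, h2, h3⟩ := h.tendsto 0 (mem_multiIndices.2 (by simp))
  have e := h1.ae_eq Metric.isOpen_ball (isWeakDeriv_zero h1.1)
  refine h3.congr fun n => eLpNorm_congr_ae ?_
  rw [indexList_zero]
  exact EventuallyEq.rfl.sub e

/-- A single mollified sequence serves all `α`, since its derivatives are, up to scalars tending to
1, the mollified weak derivatives. -/
theorem MemSobolev.exists_sobolevApprox {m : ℕ} {f : 𝔼 → ℂ} (h : MemSobolev 𝔹 m f) :
    ∃ F, SobolevApprox m f F := by
  have hB : MeasurableSet 𝔹 := Metric.isOpen_ball.measurableSet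
  set φ : ℕ → ContDiffBump (0 : 𝔼) := fun n =>
    ⟨1 / (2 * (n + 2)), 1 / (n + 2), by positivity, by
      have : (0 : ℝ) < n + 2 := by positivity
      gcongr
      linarith⟩ with hφ
  have hφ0 : Tendsto (fun n => (φ n).rOut) atTop (𝓝 0) := by
    have := tendsto_one_div_add_atTop_nhds_zero_nat (𝕜 := ℝ)
    refine ((tendsto_add_atTop_iff_nat 1).2 this).congr fun n => ?_
    simp only [hφ]
    push_cast
    ring
  have hφ1 : ∀ n, (φ n).rOut < 1 := fun n => by
    simp only [hφ]
    rw [div_lt_one (by positivity)]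
    linarith [(Nat.cast_nonneg n : (0 : ℝ) ≤ n)]
  have hind : ∀ {g : 𝔼 → ℂ}, MemLp g 2 (volume.restrict 𝔹) → MemLp (indicator 𝔹 g) 2 volume :=
    fun hg => (memLp_indicator_iff_restrict hB).2 hg
  have hloc : LocallyIntegrable (indicator 𝔹 f) :=
    (hind h.memLp).locallyIntegrable (by norm_num)
  refine ⟨fun n => mollify (φ n) (indicator 𝔹 f), fun n => contDiff_mollify _ hloc,
    fun α hα => ?_⟩
  obtain ⟨g, h1, h2⟩ := h α hα
  refine ⟨g, h1, h2, ?_⟩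
  set c : ℕ → ℝ := fun n => (1 - (φ n).rOut) ^ ∑ i, α i with hc
  have hc1 : Tendsto c atTop (𝓝 1) := by
    simpa using (hφ0.const_sub 1).pow (∑ i, α i)
  set A : ℕ → 𝔼 → ℂ := fun n => mollify (φ n) (indicator 𝔹 g) with hA
  have hAm : ∀ n, AEStronglyMeasurable (A n) (volume.restrict 𝔹) := fun n =>
    (contDiff_mollify _ ((hind h2).locallyIntegrable (by norm_num))).continuous.aestronglyMeasurable
  have hAg : Tendsto (fun n => eLpNorm (A n - g) 2 (volume.restrict 𝔹)) atTop (𝓝 0) := by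
    refine (tendsto_eLpNorm_mollify_sub hφ0 (hind h2)).congr fun n => eLpNorm_congr_ae ?_
    filter_upwards [ae_restrict_mem hB] with x hx
    simp [hA, hx]
  -- The decomposition `c A - g = c (A - g) + (c - 1) g` separates the mollification error from the
  -- chain-rule factor.
  have e : ∀ n, eLpNorm (listDeriv (indexList α) (mollify (φ n) (indicator 𝔹 f)) - g) 2
      (volume.restrict 𝔹) = eLpNorm (c n • (A n - g) + (c n - 1) • g) 2 (volume.restrict 𝔹) := by
    intro n
    refine eLpNorm_congr_ae ?_
    filter_upwards [ae_restrict_mem hB] with x hx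
    simp only [Pi.sub_apply, Pi.add_apply, Pi.smul_apply]
    rw [listDeriv_mollify (φ n) (hφ1 n) h1 hloc hx]
    change c n • A n x - g x = _
    module
  simp only [e]
  have t1 : Tendsto (fun n => ‖c n‖ₑ * eLpNorm (A n - g) 2 (volume.restrict 𝔹)) atTop
      (𝓝 (‖(1 : ℝ)‖ₑ * 0)) :=
    ENNReal.Tendsto.mul hc1.enorm (Or.inr (by simp)) hAg (Or.inr (by simp))
  have t2 : Tendsto (fun n => ‖c n - 1‖ₑ * eLpNorm g 2 (volume.restrict 𝔹)) atTop
      (𝓝 (‖(1 : ℝ) - 1‖ₑ * eLpNorm g 2 (volume.restrict 𝔹))) :=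
    ENNReal.Tendsto.mul_const (hc1.sub_const 1).enorm (Or.inr h2.eLpNorm_ne_top)
  have t := t1.add t2
  simp only [mul_zero, sub_self, enorm_zero, zero_mul, add_zero] at t
  refine tendsto_of_tendsto_of_tendsto_of_le_of_le tendsto_const_nhds t (fun _ => zero_le)
    fun n => ?_
  refine (eLpNorm_add_le (((hAm n).sub h2.1).const_smul _) (h2.1.const_smul _)
    (by norm_num)).trans ?_
  rw [eLpNorm_const_smul, eLpNorm_const_smul]

end Approximation

/-! ### The Banach algebra property for smooth functions -/

section Algebra

open Set Filter Topology
open scoped ENNReal NNReal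

variable {d : ℕ}

local notation "𝔼" => EuclideanSpace ℝ (Fin d)
local notation "𝔹" => Metric.ball (0 : EuclideanSpace ℝ (Fin d)) 1

/-- The sum of the `L²` norms on the unit ball of the partial derivatives of order at most `m`. -/
def derivNorm (m : ℕ) (F : 𝔼 → ℂ) : ℝ≥0∞ :=
  ∑ α ∈ multiIndices d m, eLpNorm (listDeriv (indexList α) F) 2 (volume.restrict 𝔹)

/-- The sum over `k ≤ 6` of the `L^{12/k}` norms on the unit ball of the `k`-th derivative. -/
def jetNorm (F : 𝔼 → ℂ) : ℝ≥0∞ :=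
  ∑ k ∈ Finset.range 7, eLpNorm (iteratedFDeriv ℝ k F) (12 / k) (volume.restrict 𝔹)

theorem continuous_iteratedFDeriv_of_smooth {F : 𝔼 → ℂ} (hF : ContDiff ℝ ∞ F) (k : ℕ) :
    Continuous (iteratedFDeriv ℝ k F) :=
  hF.continuous_iteratedFDeriv (by exact_mod_cast le_top)

theorem jetNorm_ne_top {F : 𝔼 → ℂ} (hF : ContDiff ℝ ∞ F) : jetNorm F ≠ ⊤ :=
  ENNReal.sum_ne_top.2 fun k _ =>
    (memLp_of_continuous (continuous_iteratedFDeriv_of_smooth hF k) _).eLpNorm_ne_top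

theorem one_le_twelve_div {k : ℕ} (hk : k ≤ 6) : (2 : ℝ≥0∞) ≤ 12 / k := by
  rw [ENNReal.le_div_iff_mul_le (Or.inr (by simp)) (Or.inl (by simp))]
  have : 2 * k ≤ 12 := by omega
  exact_mod_cast this

theorem jetNorm_add_le {F G : 𝔼 → ℂ} (hF : ContDiff ℝ ∞ F) (hG : ContDiff ℝ ∞ G) :
    jetNorm (F + G) ≤ jetNorm F + jetNorm G := by
  rw [jetNorm, jetNorm, jetNorm, ← Finset.sum_add_distrib]
  refine Finset.sum_le_sum fun k hk => ?_
  have hk' : k ≤ 6 := Nat.lt_succ_iff.1 (Finset.mem_range.1 hk)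
  have e : iteratedFDeriv ℝ k (F + G) = iteratedFDeriv ℝ k F + iteratedFDeriv ℝ k G := by
    funext x
    exact iteratedFDeriv_add_apply (hF.contDiffAt.of_le (by exact_mod_cast le_top))
      (hG.contDiffAt.of_le (by exact_mod_cast le_top))
  rw [e]
  exact eLpNorm_add_le (continuous_iteratedFDeriv_of_smooth hF k).aestronglyMeasurable
    (continuous_iteratedFDeriv_of_smooth hG k).aestronglyMeasurable
    (le_trans (by norm_num) (one_le_twelve_div hk'))

theorem jetNorm_zero : jetNorm (0 : 𝔼 → ℂ) = 0 := by
  refine Finset.sum_eq_zero fun k _ => ?_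
  have e : iteratedFDeriv ℝ k (0 : 𝔼 → ℂ) = 0 := iteratedFDeriv_fun_zero
  rw [e]
  exact eLpNorm_zero

/-- Reciprocals of the exponents are `i/12`, so orders of differentiation add exactly as Hölder
requires. In `ℝ≥0∞` one has `12 / 0 = ⊤`, so undifferentiated factors are covered as `L^∞`. -/
theorem holderTriple_twelve_div (i j : ℕ) :
    ENNReal.HolderTriple (12 / i : ℝ≥0∞) (12 / j) (12 / (i + j : ℕ)) := by
  refine ⟨?_⟩
  rw [ENNReal.inv_div (by simp) (by simp), ENNReal.inv_div (by simp) (by simp),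
    ENNReal.inv_div (by simp) (by simp), ENNReal.div_add_div_same, Nat.cast_add]

/-- Leibniz followed by Hölder with exponents `12/i` and `12/(k-i)`; the constant collects the
binomial coefficients. -/
theorem jetNorm_mul_le : ∃ C : ℝ≥0, ∀ F G : 𝔼 → ℂ, ContDiff ℝ ∞ F → ContDiff ℝ ∞ G →
    jetNorm (F * G) ≤ C * (jetNorm F * jetNorm G) := by
  refine ⟨∑ k ∈ Finset.range 7, ∑ i ∈ Finset.range (k + 1), (k.choose i : ℝ≥0),
    fun F G hF hG => ?_⟩
  rw [ENNReal.ofNNReal_finsetSum, Finset.sum_mul]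
  refine Finset.sum_le_sum fun k hk => ?_
  have hk' : k ≤ 6 := Nat.lt_succ_iff.1 (Finset.mem_range.1 hk)
  have hcF := continuous_iteratedFDeriv_of_smooth hF
  have hcG := continuous_iteratedFDeriv_of_smooth hG
  set T : ℕ → 𝔼 → ℝ := fun i x => (k.choose i : ℝ) *
    (‖iteratedFDeriv ℝ i F x‖ * ‖iteratedFDeriv ℝ (k - i) G x‖) with hT
  have h1 : eLpNorm (iteratedFDeriv ℝ k (F * G)) (12 / k) (volume.restrict 𝔹) ≤
      eLpNorm (∑ i ∈ Finset.range (k + 1), T i) (12 / k) (volume.restrict 𝔹) := by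
    refine eLpNorm_mono_real fun x => ?_
    rw [Finset.sum_apply]
    refine (norm_iteratedFDeriv_mul_le hF hG x (by exact_mod_cast le_top)).trans_eq ?_
    simp only [hT, mul_assoc]
  refine h1.trans ((eLpNorm_sum_le (fun i _ => ?_)
    (le_trans (by norm_num) (one_le_twelve_div hk'))).trans ?_)
  · have h2 := hcF i
    have h3 := hcG (k - i)
    exact (continuous_const.mul (h2.norm.mul h3.norm)).aestronglyMeasurable
  rw [ENNReal.ofNNReal_finsetSum, Finset.sum_mul]
  refine Finset.sum_le_sum fun i hi => ?_
  have hik : i ≤ k := Nat.lt_succ_iff.1 (Finset.mem_range.1 hi)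
  have e : T i = (k.choose i : ℝ) • ((fun x => ‖iteratedFDeriv ℝ i F x‖) •
      fun x => ‖iteratedFDeriv ℝ (k - i) G x‖) := rfl
  rw [e, eLpNorm_const_smul]
  have hC : ‖(k.choose i : ℝ)‖ₑ = ((k.choose i : ℝ≥0) : ℝ≥0∞) := by
    rw [Real.enorm_natCast]
    simp
  rw [hC]
  gcongr
  have := holderTriple_twelve_div i (k - i)
  rw [Nat.add_sub_cancel' hik] at this
  refine (eLpNorm_smul_le_mul_eLpNorm (p := 12 / i) (q := 12 / (k - i : ℕ))
    (hcG (k - i)).norm.aestronglyMeasurable (hcF i).norm.aestronglyMeasurable).trans ?_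
  rw [eLpNorm_norm, eLpNorm_norm]
  gcongr
  · exact Finset.single_le_sum
      (f := fun k : ℕ => eLpNorm (iteratedFDeriv ℝ k F) (12 / k) (volume.restrict 𝔹))
      (fun _ _ => zero_le) (Finset.mem_range.2 (by omega))
  · exact Finset.single_le_sum
      (f := fun k : ℕ => eLpNorm (iteratedFDeriv ℝ k G) (12 / k) (volume.restrict 𝔹))
      (fun _ _ => zero_le) (Finset.mem_range.2 (by omega))

theorem eLpNorm_iteratedFDeriv_le_derivNorm {F : 𝔼 → ℂ} (hF : ContDiff ℝ ∞ F) {k m : ℕ}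
    (hk : k ≤ m) : eLpNorm (iteratedFDeriv ℝ k F) 2 (volume.restrict 𝔹) ≤
      (d ^ k : ℕ) * derivNorm m F := by
  have h1 : eLpNorm (iteratedFDeriv ℝ k F) 2 (volume.restrict 𝔹) ≤
      eLpNorm (∑ s : Fin k → Fin d, fun x => ‖listDeriv (List.ofFn s) F x‖) 2
        (volume.restrict 𝔹) := by
    refine eLpNorm_mono_real fun x => ?_
    rw [Finset.sum_apply]
    exact norm_iteratedFDeriv_le_sum hF k x
  refine h1.trans ((eLpNorm_sum_le (fun s _ =>
    (contDiff_listDeriv hF _).continuous.norm.aestronglyMeasurable) (by norm_num)).trans ?_)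
  refine (Finset.sum_le_card_nsmul _ _ (derivNorm m F) fun s _ => ?_).trans_eq ?_
  · rw [eLpNorm_norm, ← listDeriv_perm hF (indexList_count_perm (List.ofFn s))]
    refine Finset.single_le_sum
      (f := fun α => eLpNorm (listDeriv (indexList α) F) 2 (volume.restrict 𝔹))
      (fun _ _ => zero_le) (mem_multiIndices.2 ?_)
    rw [sum_count, List.length_ofFn]
    exact hk
  · simp

/-- Here `s = 6 - a` counts Sobolev steps starting from `L²`, which is `12/6`. Each step passes from
`12/(a+1)` to `12/a` at the price of one derivative, and is allowed because `d/12 < 1`. -/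
theorem eLpNorm_iteratedFDeriv_le_sum (hd : d < 12) (s : ℕ) : ∀ a j : ℕ, a + s = 6 → j ≤ a →
    ∃ C : ℝ≥0, ∀ F : 𝔼 → ℂ, ContDiff ℝ ∞ F →
      eLpNorm (iteratedFDeriv ℝ j F) (12 / a) (volume.restrict 𝔹) ≤
        C * ∑ i ∈ Finset.range 7, eLpNorm (iteratedFDeriv ℝ i F) 2 (volume.restrict 𝔹) := by
  induction s with
  | zero =>
    intro a j ha hj
    refine ⟨1, fun F _ => ?_⟩
    have e : (12 / a : ℝ≥0∞) = 2 := by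
      have : a = 6 := by omega
      rw [this, eq_comm, ENNReal.eq_div_iff (by simp) (by simp)]
      norm_num
    rw [e, ENNReal.coe_one, one_mul]
    exact Finset.single_le_sum
      (f := fun k : ℕ => eLpNorm (iteratedFDeriv ℝ k F) 2 (volume.restrict 𝔹))
      (fun _ _ => zero_le) (Finset.mem_range.2 (by omega))
  | succ s ih =>
    intro a j ha hj
    obtain ⟨C₁, h₁⟩ := ih (a + 1) j (by omega) (by omega)
    obtain ⟨C₂, h₂⟩ := ih (a + 1) (j + 1) (by omega) (by omega)
    have hp : (1 : ℝ≥0∞) < 12 / (a + 1 : ℕ) :=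
      lt_of_lt_of_le (by norm_num) (one_le_twelve_div (by omega))
    have hpr : (12 / (a + 1 : ℕ) : ℝ≥0∞) < 12 / a :=
      ENNReal.div_lt_div_left (by simp) (by simp) (by exact_mod_cast Nat.lt_succ_self a)
    obtain ⟨C, h⟩ := eLpNorm_le_eLpNorm_fderiv (d := d) (V := 𝔼 [×j]→L[ℝ] ℂ) hp hpr (by
      simp only [ENNReal.toReal_div, ENNReal.toReal_natCast, ENNReal.toReal_ofNat, inv_div]
      have : (d : ℝ) < 12 := by exact_mod_cast hd
      push_cast
      linarith)
    refine ⟨C * (C₁ + C₂), fun F hF => ?_⟩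
    have hFj : ContDiff ℝ ∞ (iteratedFDeriv ℝ j F) := hF.iteratedFDeriv_right (by norm_cast)
    refine (h _ (hFj.of_le (by simp))).trans ?_
    have e : eLpNorm (fderiv ℝ (iteratedFDeriv ℝ j F)) (12 / (a + 1 : ℕ)) (volume.restrict 𝔹) =
        eLpNorm (iteratedFDeriv ℝ (j + 1) F) (12 / (a + 1 : ℕ)) (volume.restrict 𝔹) := by
      rw [← eLpNorm_norm, ← eLpNorm_norm (fderiv ℝ (iteratedFDeriv ℝ j F))]
      simp only [norm_fderiv_iteratedFDeriv]
    rw [e, ENNReal.coe_mul, ENNReal.coe_add, mul_assoc, add_mul]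
    gcongr
    · exact h₁ F hF
    · exact h₂ F hF

theorem jetNorm_le_derivNorm (hd : d < 12) : ∃ C : ℝ≥0, ∀ F : 𝔼 → ℂ, ContDiff ℝ ∞ F →
    jetNorm F ≤ C * derivNorm 6 F := by
  have h : ∀ k ∈ Finset.range 7, ∃ C : ℝ≥0, ∀ F : 𝔼 → ℂ, ContDiff ℝ ∞ F →
      eLpNorm (iteratedFDeriv ℝ k F) (12 / k) (volume.restrict 𝔹) ≤
        C * ∑ i ∈ Finset.range 7, eLpNorm (iteratedFDeriv ℝ i F) 2 (volume.restrict 𝔹) :=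
    fun k hk => eLpNorm_iteratedFDeriv_le_sum hd (6 - k) k k
      (by have := Finset.mem_range.1 hk; omega) le_rfl
  choose! C hC using h
  refine ⟨(∑ k ∈ Finset.range 7, C k) * ∑ i ∈ Finset.range 7, ((d ^ i : ℕ) : ℝ≥0), fun F hF => ?_⟩
  rw [jetNorm, ENNReal.coe_mul, ENNReal.ofNNReal_finsetSum, ENNReal.ofNNReal_finsetSum, mul_assoc,
    Finset.sum_mul, Finset.sum_mul]
  refine Finset.sum_le_sum fun k hk => (hC k hk F hF).trans ?_
  gcongr with i hi
  simpa using eLpNorm_iteratedFDeriv_le_derivNorm hF (k := i) (m := 6)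
    (Nat.lt_succ_iff.1 (Finset.mem_range.1 hi))

/-- On a set of finite measure `L^(12/k)` embeds in `L²`, as `12/k ≥ 2` for `k ≤ 6`. -/
theorem derivNorm_le_jetNorm {m : ℕ} (hm : m ≤ 6) : ∃ C : ℝ≥0, ∀ F : 𝔼 → ℂ, ContDiff ℝ ∞ F →
    derivNorm m F ≤ C * jetNorm F := by
  have h : ∀ α ∈ multiIndices d m, ∃ C : ℝ≥0, ∀ F : 𝔼 → ℂ, ContDiff ℝ ∞ F →
      eLpNorm (listDeriv (indexList α) F) 2 (volume.restrict 𝔹) ≤ C * jetNorm F := by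
    intro α hα
    have hα' : (indexList α).length ≤ 6 := by
      rw [length_indexList]
      exact (mem_multiIndices.1 hα).trans hm
    set k := (indexList α).length
    set c : ℝ≥0∞ := (volume.restrict 𝔹) univ ^
      (1 / (2 : ℝ≥0∞).toReal - 1 / (12 / k : ℝ≥0∞).toReal) with hc
    have hct : c ≠ ⊤ := by
      refine ENNReal.rpow_ne_top_of_ne_zero ?_ (measure_ne_top _ _)
      rw [Measure.restrict_apply_univ]
      exact (Metric.measure_ball_pos _ _ one_pos).ne'
    refine ⟨c.toNNReal, fun F hF => ?_⟩
    rw [ENNReal.coe_toNNReal hct]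
    have h1 : eLpNorm (listDeriv (indexList α) F) 2 (volume.restrict 𝔹) ≤
        eLpNorm (iteratedFDeriv ℝ k F) 2 (volume.restrict 𝔹) :=
      eLpNorm_mono fun x => norm_listDeriv_le hF _ x
    refine h1.trans ((eLpNorm_le_eLpNorm_mul_rpow_measure_univ (one_le_twelve_div hα')
      (continuous_iteratedFDeriv_of_smooth hF k).aestronglyMeasurable).trans ?_)
    rw [mul_comm]
    gcongr
    exact Finset.single_le_sum
      (f := fun k : ℕ => eLpNorm (iteratedFDeriv ℝ k F) (12 / k) (volume.restrict 𝔹))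
      (fun _ _ => zero_le) (Finset.mem_range.2 (by omega))
  choose! C hC using h
  refine ⟨∑ α ∈ multiIndices d m, C α, fun F hF => ?_⟩
  rw [ENNReal.ofNNReal_finsetSum, Finset.sum_mul]
  exact Finset.sum_le_sum fun α hα => hC α hα F hF

theorem jetNorm_pow_sub_pow_le (k : ℕ) : ∃ C : ℝ≥0, ∀ F G : 𝔼 → ℂ, ContDiff ℝ ∞ F →
    ContDiff ℝ ∞ G → jetNorm (F ^ (k + 1) - G ^ (k + 1)) ≤
      C * (jetNorm (F - G) * (jetNorm F + jetNorm G) ^ k) := by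
  induction k with
  | zero => exact ⟨1, fun F G _ _ => by simp⟩
  | succ k ih =>
    obtain ⟨C, hC⟩ := ih
    obtain ⟨M, hM⟩ := jetNorm_mul_le (d := d)
    refine ⟨M * C + M * C, fun F G hF hG => ?_⟩
    have e : F ^ (k + 1 + 1) - G ^ (k + 1 + 1) =
        F * (F ^ (k + 1) - G ^ (k + 1)) + (F - G) * G ^ (k + 1) := by ring
    have hs : ContDiff ℝ ∞ (F - G) := hF.sub hG
    have hGp : ContDiff ℝ ∞ (G ^ (k + 1)) := hG.pow _
    have hd : ContDiff ℝ ∞ (F ^ (k + 1) - G ^ (k + 1)) := (hF.pow _).sub hGp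
    have h1 := hM F (F ^ (k + 1) - G ^ (k + 1)) hF hd
    have h2 := hM (F - G) (G ^ (k + 1)) hs hGp
    have h3 := hC F G hF hG
    -- Comparing with 0 makes the induction hypothesis bound the power `G^(k+1)` itself.
    have h4 := hC G 0 hG contDiff_const
    rw [zero_pow (by omega), sub_zero, sub_zero, jetNorm_zero, add_zero] at h4
    rw [e, ENNReal.coe_add, ENNReal.coe_mul, add_mul]
    refine (jetNorm_add_le (hF.mul hd) (hs.mul hGp)).trans (add_le_add ?_ ?_)
    · calc _ ≤ _ := h1
        _ ≤ (M : ℝ≥0∞) * ((jetNorm F + jetNorm G) *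
            (C * (jetNorm (F - G) * (jetNorm F + jetNorm G) ^ k))) := by
          gcongr
          exact le_self_add
        _ = _ := by ring
    · calc _ ≤ _ := h2
        _ ≤ (M : ℝ≥0∞) * (jetNorm (F - G) * (C * ((jetNorm F + jetNorm G) *
            (jetNorm F + jetNorm G) ^ k))) := by
          gcongr
          refine h4.trans ?_
          gcongr
          · exact le_add_self
          · exact le_add_self
        _ = _ := by ring

end Algebra

/-! ### Polynomial nonlinearities with smooth coefficients -/

section Nonlinear

open Set Filter Topology
open scoped ENNReal NNReal

variable {d : ℕ}

local notation "𝔼" => EuclideanSpace ℝ (Fin d)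
local notation "𝔹" => Metric.ball (0 : EuclideanSpace ℝ (Fin d)) 1

/-- The nonlinear map `F ↦ A 0 F² + A 1 F³ + A 2 F⁴ + A 3 F⁵`. -/
def polyMap (A : ℕ → 𝔼 → ℂ) (F : 𝔼 → ℂ) : 𝔼 → ℂ :=
  ∑ k ∈ Finset.range 4, A k * F ^ (k + 2)

/-- The expression bounding the increments of `polyMap`. -/
def incrementBound (a b c : ℝ≥0∞) : ℝ≥0∞ := c * ((a + b) * (1 + (a + b)) ^ 3)

theorem incrementBound_mul_le (C a b c : ℝ≥0∞) :
    incrementBound (C * a) (C * b) (C * c) ≤ (C * (C * (1 + C) ^ 3)) * incrementBound a b c := by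
  have h : 1 + (C * a + C * b) ≤ (1 + C) * (1 + (a + b)) := by
    calc 1 + (C * a + C * b) ≤ 1 + (C * a + C * b) + (C + (a + b)) := le_self_add
      _ = _ := by ring
  calc incrementBound (C * a) (C * b) (C * c)
      ≤ C * c * ((C * a + C * b) * ((1 + C) * (1 + (a + b))) ^ 3) := by
        unfold incrementBound
        gcongr
    _ = _ := by
        unfold incrementBound
        ring

theorem incrementBound_mono {a b c a' b' c' : ℝ≥0∞} (ha : a ≤ a') (hb : b ≤ b') (hc : c ≤ c') :
    incrementBound a b c ≤ incrementBound a' b' c' := by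
  unfold incrementBound
  gcongr

theorem tendsto_incrementBound {ι : Type*} {l : Filter ι} {a b c : ι → ℝ≥0∞} {a' b' c' : ℝ≥0∞}
    (ha : Tendsto a l (𝓝 a')) (hb : Tendsto b l (𝓝 b')) (hc : Tendsto c l (𝓝 c'))
    (ha' : a' ≠ ⊤) (hb' : b' ≠ ⊤) (hc' : c' ≠ ⊤) :
    Tendsto (fun i => incrementBound (a i) (b i) (c i)) l (𝓝 (incrementBound a' b' c')) := by
  have hs : a' + b' ≠ ⊤ := ENNReal.add_ne_top.2 ⟨ha', hb'⟩
  have h1 : (1 + (a' + b')) ^ 3 ≠ ⊤ :=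
    ENNReal.pow_ne_top (ENNReal.add_ne_top.2 ⟨ENNReal.one_ne_top, hs⟩)
  have t1 := ha.add hb
  have t2 := ENNReal.Tendsto.pow (n := 3) (tendsto_const_nhds (x := (1 : ℝ≥0∞)).add t1)
  exact ENNReal.Tendsto.mul hc (Or.inr (ENNReal.mul_ne_top hs h1))
    (ENNReal.Tendsto.mul t1 (Or.inr h1) t2 (Or.inr hs)) (Or.inr hc')

theorem contDiff_polyMap {A : ℕ → 𝔼 → ℂ} (hA : ∀ k, ContDiff ℝ ∞ (A k)) {F : 𝔼 → ℂ}
    (hF : ContDiff ℝ ∞ F) : ContDiff ℝ ∞ (polyMap A F) := by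
  have : polyMap A F = fun x => ∑ k ∈ Finset.range 4, A k x * F x ^ (k + 2) := by
    funext x
    simp [polyMap]
  rw [this]
  exact ContDiff.sum fun k _ => (hA k).mul (hF.pow _)

theorem jetNorm_sum_le {ι : Type*} (s : Finset ι) {F : ι → 𝔼 → ℂ}
    (hF : ∀ i, ContDiff ℝ ∞ (F i)) : jetNorm (∑ i ∈ s, F i) ≤ ∑ i ∈ s, jetNorm (F i) := by
  classical
  induction s using Finset.induction_on with
  | empty => simp [jetNorm_zero]
  | insert i s hi ih =>
    rw [Finset.sum_insert hi, Finset.sum_insert hi]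
    have : ContDiff ℝ ∞ (∑ i ∈ s, F i) := by
      have e : ∑ i ∈ s, F i = fun x => ∑ i ∈ s, F i x := by
        funext x
        simp
      rw [e]
      exact ContDiff.sum fun i _ => hF i
    exact (jetNorm_add_le (hF i) this).trans (by gcongr)

/-- The coefficients, smooth on the whole space, have finite jet norm and go into the constant. The
powers of `jetNorm F + jetNorm G` that arise run from 1 to 4, so one factor splits off and the rest
is absorbed by the cube. -/
theorem jetNorm_polyMap_sub_le {A : ℕ → 𝔼 → ℂ} (hA : ∀ k, ContDiff ℝ ∞ (A k)) :
    ∃ C : ℝ≥0, ∀ F G : 𝔼 → ℂ, ContDiff ℝ ∞ F → ContDiff ℝ ∞ G →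
      jetNorm (polyMap A F - polyMap A G) ≤
        C * incrementBound (jetNorm F) (jetNorm G) (jetNorm (F - G)) := by
  obtain ⟨M, hM⟩ := jetNorm_mul_le (d := d)
  choose C hC using fun k => jetNorm_pow_sub_pow_le (d := d) (k + 1)
  refine ⟨∑ k ∈ Finset.range 4, M * ((jetNorm (A k)).toNNReal * C k), fun F G hF hG => ?_⟩
  have e : polyMap A F - polyMap A G =
      ∑ k ∈ Finset.range 4, A k * (F ^ (k + 2) - G ^ (k + 2)) := by
    simp only [polyMap, mul_sub, Finset.sum_sub_distrib]
  have hs : ∀ k, ContDiff ℝ ∞ (F ^ (k + 2) - G ^ (k + 2)) := fun k => (hF.pow _).sub (hG.pow _)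
  rw [e, ENNReal.ofNNReal_finsetSum, Finset.sum_mul]
  refine (jetNorm_sum_le _ fun k => (hA k).mul (hs k)).trans (Finset.sum_le_sum fun k hk => ?_)
  refine (hM _ _ (hA k) (hs k)).trans ?_
  rw [ENNReal.coe_mul, ENNReal.coe_mul, ENNReal.coe_toNNReal (jetNorm_ne_top (hA k)), mul_assoc,
    mul_assoc]
  gcongr
  refine (hC k F G hF hG).trans ?_
  unfold incrementBound
  have hk3 : k ≤ 3 := Nat.lt_succ_iff.1 (Finset.mem_range.1 hk)
  have hle : (jetNorm F + jetNorm G) ^ k ≤ (1 + (jetNorm F + jetNorm G)) ^ 3 :=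
    (pow_le_pow_left₀ zero_le le_add_self k).trans (pow_le_pow_right₀ le_self_add hk3)
  rw [pow_succ']
  exact mul_le_mul_right (mul_le_mul_right (mul_le_mul_right hle _) _) _

theorem derivNorm_polyMap_sub_le (hd : d < 12) {A : ℕ → 𝔼 → ℂ}
    (hA : ∀ k, ContDiff ℝ ∞ (A k)) :
    ∃ C : ℝ≥0, ∀ F G : 𝔼 → ℂ, ContDiff ℝ ∞ F → ContDiff ℝ ∞ G →
      derivNorm 5 (polyMap A F - polyMap A G) ≤
        C * incrementBound (derivNorm 6 F) (derivNorm 6 G) (derivNorm 6 (F - G)) := by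
  obtain ⟨C₁, h₁⟩ := jetNorm_polyMap_sub_le hA
  obtain ⟨C₂, h₂⟩ := derivNorm_le_jetNorm (d := d) (m := 5) (by norm_num)
  obtain ⟨C₃, h₃⟩ := jetNorm_le_derivNorm hd
  refine ⟨C₂ * (C₁ * (C₃ * (C₃ * (1 + C₃) ^ 3))), fun F G hF hG => ?_⟩
  refine (h₂ _ ((contDiff_polyMap hA hF).sub (contDiff_polyMap hA hG))).trans ?_
  rw [ENNReal.coe_mul, mul_assoc]
  gcongr
  refine (h₁ F G hF hG).trans ?_
  rw [ENNReal.coe_mul, mul_assoc]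
  gcongr
  refine (incrementBound_mono (h₃ F hF) (h₃ G hG) (h₃ _ (hF.sub hG))).trans ?_
  refine (incrementBound_mul_le _ _ _ _).trans_eq ?_
  push_cast
  rfl

/-- The sum of the `L²` norms on the unit ball of the weak derivatives of order at most `m`. -/
def weakNorm (m : ℕ) (f : 𝔼 → ℂ) : ℝ≥0∞ :=
  ∑ α ∈ multiIndices d m, eLpNorm (weakDeriv 𝔹 α f) 2 (volume.restrict 𝔹)

theorem MemSobolev.memLp_weakDeriv {m : ℕ} {f : 𝔼 → ℂ} (h : MemSobolev 𝔹 m f) {α : Fin d → ℕ}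
    (hα : α ∈ multiIndices d m) : MemLp (weakDeriv 𝔹 α f) 2 (volume.restrict 𝔹) := by
  obtain ⟨g, h1, h2⟩ := h α hα
  exact h2.ae_eq (weakDeriv_ae_eq Metric.isOpen_ball h1).symm

theorem MemSobolev.weakNorm_ne_top {m : ℕ} {f : 𝔼 → ℂ} (h : MemSobolev 𝔹 m f) :
    weakNorm m f ≠ ⊤ :=
  ENNReal.sum_ne_top.2 fun _ hα => (h.memLp_weakDeriv hα).eLpNorm_ne_top

theorem SobolevApprox.tendsto_derivNorm {m : ℕ} {f : 𝔼 → ℂ} {F : ℕ → 𝔼 → ℂ}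
    (h : SobolevApprox m f F) :
    Tendsto (fun n => derivNorm m (F n)) atTop (𝓝 (weakNorm m f)) := by
  refine tendsto_finsetSum _ fun α hα => ?_
  obtain ⟨g, h1, h2, h3⟩ := h.tendsto α hα
  rw [eLpNorm_congr_ae (weakDeriv_ae_eq Metric.isOpen_ball h1)]
  exact tendsto_eLpNorm_of_tendsto_sub
    (fun n => (contDiff_listDeriv (h.smooth n) _).continuous.aestronglyMeasurable) h2 h3

theorem SobolevApprox.tendsto_derivNorm_sub {m : ℕ} {f : 𝔼 → ℂ} {F : ℕ → 𝔼 → ℂ}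
    (h : SobolevApprox m f F) :
    Tendsto (fun p : ℕ × ℕ => derivNorm m (F p.1 - F p.2)) atTop (𝓝 0) := by
  rw [← Finset.sum_const_zero (s := multiIndices d m) (ι := Fin d → ℕ)]
  refine tendsto_finsetSum _ fun α hα => ?_
  obtain ⟨g, h1, h2, h3⟩ := h.tendsto α hα
  have ht : Tendsto (fun p : ℕ × ℕ =>
      eLpNorm (listDeriv (indexList α) (F p.1) - g) 2 (volume.restrict 𝔹) +
      eLpNorm (listDeriv (indexList α) (F p.2) - g) 2 (volume.restrict 𝔹)) atTop (𝓝 (0 + 0)) := by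
    rw [← prod_atTop_atTop_eq]
    exact (h3.comp tendsto_fst).add (h3.comp tendsto_snd)
  rw [add_zero] at ht
  refine tendsto_of_tendsto_of_tendsto_of_le_of_le tendsto_const_nhds ht (fun _ => zero_le)
    fun p => ?_
  rw [listDeriv_sub (h.smooth _) (h.smooth _),
    ← sub_sub_sub_cancel_right _ _ g]
  exact eLpNorm_sub_le
    ((contDiff_listDeriv (h.smooth _) _).continuous.aestronglyMeasurable.sub h2.1)
    ((contDiff_listDeriv (h.smooth _) _).continuous.aestronglyMeasurable.sub h2.1) (by norm_num)

theorem exists_tendsto_eLpNorm_of_cauchy {X V : Type*} [MeasurableSpace X] [NormedAddCommGroup V]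
    [CompleteSpace V] {μ : Measure X} {F : ℕ → X → V} (hF : ∀ n, MemLp (F n) 2 μ)
    (h : Tendsto (fun p : ℕ × ℕ => eLpNorm (F p.1 - F p.2) 2 μ) atTop (𝓝 0)) :
    ∃ g, MemLp g 2 μ ∧ Tendsto (fun n => eLpNorm (F n - g) 2 μ) atTop (𝓝 0) := by
  have hc : CauchySeq fun n => (hF n).toLp (F n) := by
    rw [EMetric.cauchySeq_iff]
    intro ε hε
    obtain ⟨N, hN⟩ := eventually_atTop.1 (h.eventually_lt_const hε)
    refine ⟨max N.1 N.2, fun m hm n hn => ?_⟩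
    rw [Lp.edist_toLp_toLp]
    exact hN (m, n) ⟨(le_max_left _ _).trans hm, (le_max_right _ _).trans hn⟩
  obtain ⟨g, hg⟩ := cauchySeq_tendsto_of_complete hc
  refine ⟨g, Lp.memLp g, ?_⟩
  rw [tendsto_iff_edist_tendsto_0] at hg
  refine hg.congr fun n => ?_
  rw [Lp.edist_def]
  exact eLpNorm_congr_ae ((hF n).coeFn_toLp.sub EventuallyEq.rfl)

/-- Completeness of `L²` gives a limit for every derivative separately. An almost everywhere
convergent subsequence identifies the zeroth limit with `q`, and closedness makes the others its
weak derivatives. -/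
theorem sobolevApprox_of_cauchy {m : ℕ} {q : 𝔼 → ℂ} {Q : ℕ → 𝔼 → ℂ}
    (hQ : ∀ n, ContDiff ℝ ∞ (Q n))
    (hc : Tendsto (fun p : ℕ × ℕ => derivNorm m (Q p.1 - Q p.2)) atTop (𝓝 0))
    {ns : ℕ → ℕ} (hns : StrictMono ns)
    (hq : ∀ᵐ x ∂volume.restrict 𝔹, Tendsto (fun n => Q (ns n) x) atTop (𝓝 (q x))) :
    SobolevApprox m q Q := by
  have hcα : ∀ α ∈ multiIndices d m, ∃ g, MemLp g 2 (volume.restrict 𝔹) ∧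
      Tendsto (fun n => eLpNorm (listDeriv (indexList α) (Q n) - g) 2 (volume.restrict 𝔹))
        atTop (𝓝 0) := by
    intro α hα
    refine exists_tendsto_eLpNorm_of_cauchy (fun n =>
      memLp_of_continuous (contDiff_listDeriv (hQ n) _).continuous 2) ?_
    refine tendsto_of_tendsto_of_tendsto_of_le_of_le tendsto_const_nhds hc (fun _ => zero_le)
      fun p => ?_
    simp only [← listDeriv_sub (hQ _) (hQ _)]
    exact Finset.single_le_sum (f := fun α => eLpNorm
      (listDeriv (indexList α) (Q p.1 - Q p.2)) 2 (volume.restrict 𝔹)) (fun _ _ => zero_le) hα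
  obtain ⟨g₀, h1, h2⟩ := hcα 0 (mem_multiIndices.2 (by simp))
  simp only [indexList_zero] at h2
  change Tendsto (fun n => eLpNorm (Q n - g₀) 2 (volume.restrict 𝔹)) atTop (𝓝 0) at h2
  have hm := tendstoInMeasure_of_tendsto_eLpNorm (p := 2) (by norm_num)
    (fun n => (hQ (ns n)).continuous.aestronglyMeasurable) h1.1 (h2.comp hns.tendsto_atTop)
  obtain ⟨ms, hms, hae⟩ := hm.exists_seq_tendsto_ae
  have hqg : q =ᵐ[volume.restrict 𝔹] g₀ := by
    filter_upwards [hq, hae] with x hx hx'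
    exact tendsto_nhds_unique (hx.comp hms.tendsto_atTop) hx'
  have hq2 : MemLp q 2 (volume.restrict 𝔹) := h1.ae_eq hqg.symm
  have hQq : Tendsto (fun n => eLpNorm (Q n - q) 2 (volume.restrict 𝔹)) atTop (𝓝 0) :=
    h2.congr fun n => eLpNorm_congr_ae (EventuallyEq.rfl.sub hqg.symm)
  refine ⟨hQ, fun α hα => ?_⟩
  obtain ⟨g, hg1, hg2⟩ := hcα α hα
  exact ⟨g, isWeakDeriv_of_tendsto hQ hq2 hg1 hQq hg2, hg1, hg2⟩

/-- The increment bound between two members of the sequence tends to 0, since the norms converge and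
the differences vanish; pointwise convergence along a subsequence of `F` passes through the
polynomial. -/
theorem SobolevApprox.polyMap (hd : d < 12) {A : ℕ → 𝔼 → ℂ} (hA : ∀ k, ContDiff ℝ ∞ (A k))
    {f q : 𝔼 → ℂ} {F : ℕ → 𝔼 → ℂ} (h : SobolevApprox 6 f F)
    (hq : q =ᵐ[volume.restrict 𝔹] polyMap A f) :
    SobolevApprox 5 q fun n => RadialWave.polyMap A (F n) := by
  obtain ⟨C, hC⟩ := derivNorm_polyMap_sub_le hd hA
  have hm := tendstoInMeasure_of_tendsto_eLpNorm (p := 2) (by norm_num)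
    (fun n => (h.smooth n).continuous.aestronglyMeasurable) h.memSobolev.memLp.1
    h.tendsto_eLpNorm_sub
  obtain ⟨ns, hns, hae⟩ := hm.exists_seq_tendsto_ae
  refine sobolevApprox_of_cauchy (fun n => contDiff_polyMap hA (h.smooth n)) ?_ hns ?_
  · have hw := h.memSobolev.weakNorm_ne_top
    have t : Tendsto (fun p : ℕ × ℕ => incrementBound (derivNorm 6 (F p.1)) (derivNorm 6 (F p.2))
        (derivNorm 6 (F p.1 - F p.2))) atTop (𝓝 (incrementBound (weakNorm 6 f) (weakNorm 6 f) 0)) := by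
      refine tendsto_incrementBound ?_ ?_ h.tendsto_derivNorm_sub hw hw ENNReal.zero_ne_top
      · rw [← prod_atTop_atTop_eq]
        exact h.tendsto_derivNorm.comp tendsto_fst
      · rw [← prod_atTop_atTop_eq]
        exact h.tendsto_derivNorm.comp tendsto_snd
    have t' := ENNReal.Tendsto.const_mul (a := (C : ℝ≥0∞)) t (Or.inr ENNReal.coe_ne_top)
    simp only [incrementBound, zero_mul, mul_zero] at t'
    exact tendsto_of_tendsto_of_tendsto_of_le_of_le tendsto_const_nhds t' (fun _ => zero_le)
      fun p => hC _ _ (h.smooth _) (h.smooth _)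
  · filter_upwards [hae, hq] with x hx hx'
    rw [hx']
    simp only [RadialWave.polyMap, Finset.sum_apply, Pi.mul_apply, Pi.pow_apply]
    exact tendsto_finsetSum _ fun k _ => (hx.pow _).const_mul _

theorem weakNorm_polyMap_sub_le (hd : d < 12) {A : ℕ → 𝔼 → ℂ} (hA : ∀ k, ContDiff ℝ ∞ (A k)) :
    ∃ C : ℝ≥0, ∀ f g q r : 𝔼 → ℂ, MemSobolev 𝔹 6 f → MemSobolev 𝔹 6 g →
      q =ᵐ[volume.restrict 𝔹] polyMap A f → r =ᵐ[volume.restrict 𝔹] polyMap A g →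
      MemSobolev 𝔹 6 (f - g) ∧ MemSobolev 𝔹 5 (q - r) ∧ weakNorm 5 (q - r) ≤
        C * incrementBound (weakNorm 6 f) (weakNorm 6 g) (weakNorm 6 (f - g)) := by
  obtain ⟨C, hC⟩ := derivNorm_polyMap_sub_le hd hA
  refine ⟨C, fun f g q r hf hg hq hr => ?_⟩
  obtain ⟨F, hF⟩ := hf.exists_sobolevApprox
  obtain ⟨G, hG⟩ := hg.exists_sobolevApprox
  have hQ := (hF.polyMap hd hA hq).sub (hG.polyMap hd hA hr)
  have hFG := hF.sub hG
  refine ⟨hFG.memSobolev, hQ.memSobolev, ?_⟩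
  refine le_of_tendsto_of_tendsto' hQ.tendsto_derivNorm
    (ENNReal.Tendsto.const_mul (tendsto_incrementBound hF.tendsto_derivNorm hG.tendsto_derivNorm
      hFG.tendsto_derivNorm hf.weakNorm_ne_top hg.weakNorm_ne_top hFG.memSobolev.weakNorm_ne_top)
      (Or.inr ENNReal.coe_ne_top)) fun n => hC _ _ (hF.smooth n) (hG.smooth n)

/-! ### Comparison of the `ℓ¹`-type and `ℓ²`-type Sobolev norms -/

theorem MemSobolev.integral_norm_weakDeriv_sq {m : ℕ} {f : 𝔼 → ℂ} (h : MemSobolev 𝔹 m f)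
    {α : Fin d → ℕ} (hα : α ∈ multiIndices d m) :
    ∫ x in 𝔹, ‖weakDeriv 𝔹 α f x‖ ^ 2 =
      (eLpNorm (weakDeriv 𝔹 α f) 2 (volume.restrict 𝔹)).toReal ^ 2 := by
  have hm := h.memLp_weakDeriv hα
  rw [hm.eLpNorm_eq_integral_rpow_norm (by simp) (by simp), ENNReal.toReal_ofReal (by positivity),
    ← Real.rpow_natCast, ← Real.rpow_mul (by positivity)]
  simp

theorem MemSobolev.toReal_weakNorm {m : ℕ} {f : 𝔼 → ℂ} (h : MemSobolev 𝔹 m f) :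
    (weakNorm m f).toReal =
      ∑ α ∈ multiIndices d m, (eLpNorm (weakDeriv 𝔹 α f) 2 (volume.restrict 𝔹)).toReal :=
  ENNReal.toReal_sum fun _ hα => (h.memLp_weakDeriv hα).eLpNorm_ne_top

theorem MemSobolev.sobolevNorm_le {m : ℕ} {f : 𝔼 → ℂ} (h : MemSobolev 𝔹 m f) :
    sobolevNorm 𝔹 m f ≤ (weakNorm m f).toReal := by
  rw [sobolevNorm, Finset.sum_congr rfl fun α hα => h.integral_norm_weakDeriv_sq hα,
    h.toReal_weakNorm, Real.sqrt_le_left (by positivity)]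
  exact Finset.sum_sq_le_sq_sum_of_nonneg fun _ _ => ENNReal.toReal_nonneg

theorem MemSobolev.le_sobolevNorm {m : ℕ} {f : 𝔼 → ℂ} (h : MemSobolev 𝔹 m f) :
    (weakNorm m f).toReal ≤ (multiIndices d m).card * sobolevNorm 𝔹 m f := by
  rw [h.toReal_weakNorm, ← nsmul_eq_mul]
  refine Finset.sum_le_card_nsmul _ _ _ fun α hα => ?_
  rw [sobolevNorm, Finset.sum_congr rfl fun α hα => h.integral_norm_weakDeriv_sq hα]
  refine Real.le_sqrt_of_sq_le ?_
  exact Finset.single_le_sum (f := fun α =>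
    (eLpNorm (weakDeriv 𝔹 α f) 2 (volume.restrict 𝔹)).toReal ^ 2) (fun _ _ => by positivity) hα

theorem isWeakDeriv_zero_zero (α : Fin d → ℕ) : IsWeakDeriv 𝔹 α 0 0 :=
  ⟨locallyIntegrableOn_of_memLp MemLp.zero, locallyIntegrableOn_of_memLp MemLp.zero,
    fun φ _ _ _ => by simp⟩

theorem memSobolev_zero (m : ℕ) : MemSobolev 𝔹 m 0 := fun α _ =>
  ⟨0, isWeakDeriv_zero_zero α, MemLp.zero⟩

theorem sobolevNorm_zero (m : ℕ) : sobolevNorm 𝔹 m 0 = 0 := by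
  have h : ∀ α : Fin d → ℕ, ∫ x in 𝔹, ‖weakDeriv 𝔹 α 0 x‖ ^ 2 = 0 := fun α => by
    rw [integral_eq_zero_of_ae]
    filter_upwards [weakDeriv_ae_eq Metric.isOpen_ball (isWeakDeriv_zero_zero α)] with x hx
    rw [hx]
    simp
  simp [sobolevNorm, h]

end Nonlinear

/-! ### The nonlinearity of the wave equation -/

section Coefficients

/-- A smooth function on `ℝ^11` with values in `[0, 144/100]` that equals `‖ξ‖²` on the unit ball. -/
def truncSq (ξ : EuclideanSpace ℝ (Fin 11)) : ℝ :=
  (⟨1, 6 / 5, one_pos, by norm_num⟩ : ContDiffBump (0 : EuclideanSpace ℝ (Fin 11))) ξ * ‖ξ‖ ^ 2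

theorem contDiff_truncSq : ContDiff ℝ ∞ truncSq :=
  (ContDiffBump.contDiff _).mul (contDiff_norm_sq ℝ)

theorem truncSq_eq {ξ : EuclideanSpace ℝ (Fin 11)} (hξ : ξ ∈ unitBall) : truncSq ξ = ‖ξ‖ ^ 2 := by
  rw [truncSq, ContDiffBump.one_of_mem_closedBall _ (Metric.ball_subset_closedBall hξ), one_mul]

/-- The bound `(6/5)²` keeps `155 - 74 * truncSq ξ` positive everywhere, so that `phiQuot` is smooth
on the whole space. -/
theorem truncSq_le (ξ : EuclideanSpace ℝ (Fin 11)) : truncSq ξ ≤ 36 / 25 := by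
  rw [truncSq]
  set χ : ContDiffBump (0 : EuclideanSpace ℝ (Fin 11)) := ⟨1, 6 / 5, one_pos, by norm_num⟩ with hχ
  by_cases h : ‖ξ‖ < 6 / 5
  · have h1 : χ ξ ≤ 1 := χ.le_one
    have h2 : 0 ≤ χ ξ := χ.nonneg
    nlinarith [norm_nonneg ξ]
  · rw [χ.zero_of_le_dist (by simpa [hχ] using h)]
    norm_num

/-- A smooth function on `ℝ^11` that equals `φ₀(|ξ|)/|ξ|` on the punctured unit ball. -/
def phiQuot (ξ : EuclideanSpace ℝ (Fin 11)) : ℝ := 3 / √(2 * (155 - 74 * truncSq ξ))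

theorem contDiff_phiQuot : ContDiff ℝ ∞ phiQuot := by
  have h : ∀ ξ, 0 < 2 * (155 - 74 * truncSq ξ) := fun ξ => by
    linarith [truncSq_le ξ]
  have hs : ContDiff ℝ ∞ fun ξ => √(2 * (155 - 74 * truncSq ξ)) :=
    (contDiff_const.mul (contDiff_const.sub (contDiff_const.mul contDiff_truncSq))).sqrt
      fun ξ => (h ξ).ne'
  exact contDiff_const.div hs fun ξ => (Real.sqrt_pos.2 (h ξ)).ne'

/-- The coefficient of `z^(k+2)` in `N(|ξ|, z)`, as a smooth function of `ξ`. -/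
def coeffN (k : ℕ) (ξ : EuclideanSpace ℝ (Fin 11)) : ℂ :=
  (match k with
    | 0 => -336 * phiQuot ξ + 8880 * phiQuot ξ ^ 3 * truncSq ξ
    | 1 => -112 + 8880 * phiQuot ξ ^ 2 * truncSq ξ
    | 2 => 4440 * phiQuot ξ * truncSq ξ
    | _ => 888 * truncSq ξ : ℝ)

theorem contDiff_coeffN (k : ℕ) : ContDiff ℝ ∞ (coeffN k) := by
  have h1 := contDiff_phiQuot
  have h2 := contDiff_truncSq
  refine Complex.ofRealCLM.contDiff.comp ?_
  match k with
  | 0 => fun_prop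
  | 1 => fun_prop
  | 2 => fun_prop
  | n + 3 => fun_prop

theorem deriv_nPoly (x : ℂ) : deriv nPoly x = 42 * x ^ 2 - 555 * x ^ 4 := by
  have h : HasDerivAt nPoly (14 * (((3 : ℕ) : ℂ) * x ^ (3 - 1)) - 111 * (((5 : ℕ) : ℂ) * x ^ (5 - 1)))
      x := ((hasDerivAt_pow 3 x).const_mul 14).sub ((hasDerivAt_pow 5 x).const_mul 111)
  rw [h.deriv]
  norm_num
  ring

/-- With `φ₀ = ρψ`, the remainder of `nPoly` is divisible by `ρ³`. The origin is excluded because `8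
/ 0 ^ 3 = 0` there makes `scalarN` vanish, while the polynomial need not; a single point is a null
set. -/
theorem radialExt_scalarN (u : ℝ → ℂ) {ξ : EuclideanSpace ℝ (Fin 11)} (hξ : ξ ∈ unitBall)
    (h0 : ξ ≠ 0) :
    radialExt (fun ρ => scalarN ρ (u ρ)) ξ = polyMap coeffN (radialExt u) ξ := by
  have hρ : (‖ξ‖ : ℂ) ≠ 0 := by exact_mod_cast (norm_pos_iff.2 h0).ne'
  have hφ : phi0 ‖ξ‖ = phiQuot ξ * ‖ξ‖ := by
    rw [phi0, phiQuot, truncSq_eq hξ]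
    ring
  simp only [radialExt, polyMap, Finset.sum_apply, Pi.mul_apply, Pi.pow_apply,
    Finset.sum_range_succ, Finset.sum_range_zero, zero_add, coeffN, scalarN, deriv_nPoly, nPoly, hφ,
    truncSq_eq hξ]
  push_cast
  field_simp
  ring

theorem radialExt_scalarN_ae (u : ℝ → ℂ) :
    radialExt (fun ρ => scalarN ρ (u ρ)) =ᵐ[volume.restrict unitBall]
      polyMap coeffN (radialExt u) := by
  filter_upwards [ae_restrict_mem Metric.isOpen_ball.measurableSet,
    ae_restrict_of_ae (Measure.ae_ne volume (0 : EuclideanSpace ℝ (Fin 11)))] with ξ hξ h0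
  exact radialExt_scalarN u hξ h0

theorem memHRad_scalarN {u : ℝ → ℂ} (hu : MemHRad 6 u) :
    MemHRad 5 fun ρ => scalarN ρ (u ρ) := by
  obtain ⟨F, hF⟩ := MemSobolev.exists_sobolevApprox hu
  exact (hF.polyMap (by norm_num) contDiff_coeffN (radialExt_scalarN_ae u)).memSobolev

theorem normHRad_nonneg (m : ℕ) (u : ℝ → ℂ) : 0 ≤ normHRad m u := Real.sqrt_nonneg _

theorem normHRad_six_le_normH (u : (ℝ → ℂ) × (ℝ → ℂ)) : normHRad 6 u.1 ≤ normH u :=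
  Real.le_sqrt_of_sq_le (le_add_of_nonneg_right (sq_nonneg _))

/-- Converts the bound to the `ℓ²`-type norms. The single constant `K D² + D` dominates both the
outer factor `K D²` and the inner factor `D`. -/
theorem increment_rescale_le {K D a b c x y z : ℝ} (hK : 0 ≤ K) (hD : 0 ≤ D) (ha : 0 ≤ a)
    (hb : 0 ≤ b) (hc : 0 ≤ c) (hx : 0 ≤ x) (hy : 0 ≤ y) (hxa : x ≤ D * a)
    (hyb : y ≤ D * b) (hzc : z ≤ D * c) :
    K * (z * ((x + y) * (1 + (x + y)) ^ 3)) ≤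
      (K * D ^ 2 + D) * (c * ((a + b) * (1 + (K * D ^ 2 + D) * (a + b)) ^ 3)) := by
  calc K * (z * ((x + y) * (1 + (x + y)) ^ 3))
      ≤ K * ((D * c) * ((D * a + D * b) * (1 + (D * a + D * b)) ^ 3)) := by gcongr
    _ = K * D ^ 2 * (c * ((a + b) * (1 + D * (a + b)) ^ 3)) := by ring
    _ ≤ _ := by
      gcongr
      · exact le_add_of_nonneg_right hD
      · exact le_add_of_nonneg_left (by positivity)

theorem normHRad_scalarN_sub_le : ∃ C : ℝ, 0 ≤ C ∧ ∀ u v : ℝ → ℂ, MemHRad 6 u → MemHRad 6 v →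
    normHRad 5 ((fun ρ => scalarN ρ (u ρ)) - fun ρ => scalarN ρ (v ρ)) ≤
      C * (normHRad 6 (u - v) * ((normHRad 6 u + normHRad 6 v) *
        (1 + C * (normHRad 6 u + normHRad 6 v)) ^ 3)) := by
  obtain ⟨C, hC⟩ := weakNorm_polyMap_sub_le (d := 11) (by norm_num) contDiff_coeffN
  set D : ℝ := ((multiIndices 11 6).card : ℝ) with hD
  have hD0 : 0 ≤ D := Nat.cast_nonneg _
  refine ⟨C * D ^ 2 + D, by positivity, fun u v hu hv => ?_⟩
  obtain ⟨h1, h2, h3⟩ := hC _ _ _ _ hu hv (radialExt_scalarN_ae u) (radialExt_scalarN_ae v)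
  have hub : (weakNorm 6 (radialExt u)).toReal ≤ D * normHRad 6 u := MemSobolev.le_sobolevNorm hu
  have hvb : (weakNorm 6 (radialExt v)).toReal ≤ D * normHRad 6 v := MemSobolev.le_sobolevNorm hv
  have hwb : (weakNorm 6 (radialExt u - radialExt v)).toReal ≤ D * normHRad 6 (u - v) :=
    h1.le_sobolevNorm
  have hu' : weakNorm 6 (radialExt u) ≠ ⊤ := MemSobolev.weakNorm_ne_top hu
  have hv' : weakNorm 6 (radialExt v) ≠ ⊤ := MemSobolev.weakNorm_ne_top hv
  have hw' := h1.weakNorm_ne_top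
  have hs : weakNorm 6 (radialExt u) + weakNorm 6 (radialExt v) ≠ ⊤ :=
    ENNReal.add_ne_top.2 ⟨hu', hv'⟩
  have hs' : 1 + (weakNorm 6 (radialExt u) + weakNorm 6 (radialExt v)) ≠ ⊤ :=
    ENNReal.add_ne_top.2 ⟨ENNReal.one_ne_top, hs⟩
  have h4 := ENNReal.toReal_mono (ENNReal.mul_ne_top ENNReal.coe_ne_top (ENNReal.mul_ne_top hw'
    (ENNReal.mul_ne_top hs (ENNReal.pow_ne_top hs')))) h3
  rw [ENNReal.toReal_mul, ENNReal.toReal_mul, ENNReal.toReal_mul,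
    ENNReal.toReal_pow, ENNReal.toReal_add ENNReal.one_ne_top hs, ENNReal.toReal_add hu' hv',
    ENNReal.toReal_one, ENNReal.coe_toReal] at h4
  refine (h2.sobolevNorm_le.trans h4).trans ?_
  exact increment_rescale_le C.2 hD0 (normHRad_nonneg _ _) (normHRad_nonneg _ _)
    (normHRad_nonneg _ _) ENNReal.toReal_nonneg ENNReal.toReal_nonneg
    hub hvb hwb

theorem normH_opN_sub (u v : (ℝ → ℂ) × (ℝ → ℂ)) :
    normH (opN u - opN v) =
      normHRad 5 ((fun ρ => scalarN ρ (u.1 ρ)) - fun ρ => scalarN ρ (v.1 ρ)) := by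
  have h0 : normHRad 6 (0 - 0) = 0 := by
    rw [sub_zero]
    exact sobolevNorm_zero 6
  change √(normHRad 6 (0 - 0) ^ 2 + normHRad 5 (_ - _) ^ 2) = _
  rw [h0, zero_pow two_ne_zero, zero_add, Real.sqrt_sq (normHRad_nonneg _ _)]
  rfl

/-- On the ball of radius `δ` the cubic factor is bounded by a constant, leaving the sum of norms
times the norm of the difference. -/
theorem increment_le_of_le {C δ a b c x y z : ℝ} (hC : 0 ≤ C) (ha : 0 ≤ a) (hb : 0 ≤ b)
    (hc : 0 ≤ c) (hx : a ≤ x) (hy : b ≤ y) (hz : c ≤ z) (hxδ : x ≤ δ) (hyδ : y ≤ δ) :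
    C * (c * ((a + b) * (1 + C * (a + b)) ^ 3)) ≤
      (C * (1 + C * (δ + δ)) ^ 3 + 1) * ((x + y) * z) := by
  have hx0 : 0 ≤ x := ha.trans hx
  have hy0 : 0 ≤ y := hb.trans hy
  have hz0 : 0 ≤ z := hc.trans hz
  have h0 : 0 ≤ (x + y) * z := by positivity
  have h1 : a ≤ δ := hx.trans hxδ
  have h2 : b ≤ δ := hy.trans hyδ
  calc C * (c * ((a + b) * (1 + C * (a + b)) ^ 3))
      ≤ C * (z * ((x + y) * (1 + C * (δ + δ)) ^ 3)) := by gcongr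
    _ = C * (1 + C * (δ + δ)) ^ 3 * ((x + y) * z) := by ring
    _ ≤ _ := by
      rw [add_mul _ 1, one_mul]
      exact le_add_of_nonneg_right h0

end Coefficients

end RadialWave

end

theorem mainTheorem11 (δ : ℝ) (hδ : 0 < δ) :
    (∀ u ∈ RadialWave.ballH δ, RadialWave.opN u ∈ RadialWave.spaceH) ∧
      ∃ c : ℝ, 0 < c ∧ ∀ u ∈ RadialWave.ballH δ, ∀ v ∈ RadialWave.ballH δ,
        RadialWave.normH (RadialWave.opN u - RadialWave.opN v) ≤
          c * ((RadialWave.normH u + RadialWave.normH v) * RadialWave.normH (u - v)) := by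
  refine ⟨fun u hu => ⟨RadialWave.memSobolev_zero 6, RadialWave.memHRad_scalarN hu.1.1⟩, ?_⟩
  obtain ⟨C, hC0, hC⟩ := RadialWave.normHRad_scalarN_sub_le
  -- The summand 1 makes the constant strictly positive, `C` being only nonnegative.
  refine ⟨C * (1 + C * (δ + δ)) ^ 3 + 1, by positivity, fun u hu v hv => ?_⟩
  rw [RadialWave.normH_opN_sub]
  exact (hC u.1 v.1 hu.1.1 hv.1.1).trans (RadialWave.increment_le_of_le hC0
    (RadialWave.normHRad_nonneg _ _) (RadialWave.normHRad_nonneg _ _)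
    (RadialWave.normHRad_nonneg _ _) (RadialWave.normHRad_six_le_normH u)
    (RadialWave.normHRad_six_le_normH v) (RadialWave.normHRad_six_le_normH (u - v)) hu.2 hv.2)
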